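/- All systems are finite-dimensional. Alice holds all systems labelled by $A$, Bob all systems labelled by $B$. An \emph{LOCC channel} $\mathcal{L}_{AB\to A_1B_1}$ is a bipartite quantum channel of the form $\mathcal{L}=\sum_y\mathcal{E}^y_{A\to A_1}\otimes\mathcal{F}^y_{B\to B_1}$ (finite sum), with all $\mathcal{E}^y,\mathcal{F}^y$ completely positive and trace non-increasing. A channel $\mathcal{N}_{A\to B}$ is \emph{teleportation-simulable with associated resource state} $\omega_{A'B'}$ if there is an LOCC channel $\mathcal{L}_{AA'B'\to B}$ with $\mathcal{N}(\rho_A)=\mathcal{L}(\rho_A\otimes\omega_{A'B'})$ for all states $\rho_A$. \emph{Sequential simulation codes.} Let $n,M\ge 1$ and $\eta\in[0,1]$. A sequential protocol consists of a maximally entangled state $\Phi_{\bar A_0\bar B_0}$ of Schmidt rank $M$ and LOCC channels $\mathcal{L}^{(i)}_{A_i\bar A_{i-1}\bar B_{i-1}\to B_i\bar A_i\bar B_i}$, $1\le i\le n$. A discrimination strategy consists of a reference sequence $R_1,\dots,R_n$, a state $\rho_{R_1A_1}$ and channels $\mathcal{A}^{(i)}_{R_iB_i\to R_{i+1}A_{i+1}}$,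 $1\le i\le n-1$. For the actual channel, put $\rho_{R_iB_i}=\mathcal{N}_{A_i\to B_i}(\rho_{R_iA_i})$ and $\rho_{R_{i+1}A_{i+1}}=\mathcal{A}^{(i)}(\rho_{R_iB_i})$. For the simulation, put $\tau_{R_1A_1\bar A_0\bar B_0}=\rho_{R_1A_1}\otimes\Phi_{\bar A_0\bar B_0}$, $\tau_{R_iB_i\bar A_i\bar B_i}=\mathcal{L}^{(i)}(\tau_{R_iA_i\bar A_{i-1}\bar B_{i-1}})$ and $\tau_{R_{i+1}A_{i+1}\bar A_i\bar B_i}=\mathcal{A}^{(i)}(\tau_{R_iB_i\bar A_i\bar B_i})$. The protocol is an \emph{$(n,M,\eta)$ sequential channel simulation code} for $\mathcal{N}$ if $\frac12\|\rho_{R_nB_n}-\tau_{R_nB_n}\|_1\le\eta$ for every discrimination strategy. \emph{Smooth entanglement of formation.} For a bipartite state (or non-zero positive semidefinite operator) $\xi_{KL}$ let $$H_0(K|L)_\xi=\max_{\sigma_L}\log_2\operatorname{Tr}\{\Pi^{\xi}_{KL}(I_K\otimes\sigma_L)\},$$ where $\Pi^\xi_{KL}$ is the projection onto the support of $\xi_{KL}$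 and $\sigma_L$ ranges over density operators. For $\delta\in(0,1)$ and a state $\tau_{CD}$, let $$E_{F,0}^{\delta}(C;D)_\tau=\min H_0(C|X)_{\tilde\tau},$$ where the minimum is over all finite pure-state ensembles $\{p(x),\phi^x_{CD}\}$ with $\tau_{CD}=\sum_x p(x)\phi^x_{CD}$ and all operators $\tilde\tau_{XC}=\sum_x|x\rangle\langle x|_X\otimes\tilde\tau^x_C\ge 0$ with $\|\tilde\tau_{XC}-\tau_{XC}\|_1\le\delta$, and $\tau_{XC}=\sum_xp(x)|x\rangle\langle x|_X\otimes\operatorname{Tr}_D\{\phi^x_{CD}\}$. \textbf{Proposition.} Let $\mathcal{N}_{A\to B}$ be a quantum channel that is teleportation-simulable with associated resource state $\omega_{A'B'}$. Let $n\ge 1$ be an integer and $\varepsilon\in(0,1)$. Then there exist an integer $M\ge 1$ and an $(n,M,\sqrt{\varepsilon})$ sequential channel simulation code for $\mathcal{N}$ with $$\frac1n\log_2M\le\frac1nE_{F,0}^{\varepsilon/2}(A'^n;B'^n)_{\omega^{\otimes n}}.$$ -/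

import Mathlib

open scoped Kronecker ComplexOrder

noncomputable section

namespace ChannelSim

/-! ## Operators, states and linear maps on finite-dimensional systems

A quantum system with a fixed orthonormal basis is a finite type `a`; its operators are the complex
`a × a` matrices, and the composite of `a` and `b` is the product type `a × b`. -/

/-- Operators on the system `a`. -/
abbrev Op (a : Type*) := Matrix a a ℂ

/-- Linear maps from operators on `a` to operators on `b`. -/
abbrev SuperOp (a b : Type*) := Op a →ₗ[ℂ] Op b

section Basic

variable {a b c d r : Type*}

/-- Density operators. -/
def IsDensity [Fintype a] (ρ : Op a) : Prop := ρ.PosSemidef ∧ ρ.trace = 1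

/-- Partial trace over the second factor. -/
def partialTraceRight [Fintype b] (X : Op (a × b)) : Op a :=
  Matrix.of fun i j => ∑ k, X (i, k) (j, k)

/-- Trace norm `‖X‖₁ = Tr √(X† X)`; the square root is the functional calculus of the Hermitian
matrix `X† X`. -/
def traceNorm [Fintype a] [DecidableEq a] (X : Op a) : ℝ :=
  ((Matrix.isHermitian_conjTranspose_mul_self X).cfc Real.sqrt).trace.re

/-- `id_r ⊗ Φ`. -/
def idTensor (r : Type*) (Φ : SuperOp a b) : SuperOp (r × a) (r × b) where
  toFun X := Matrix.of fun p q => Φ (Matrix.of fun i j => X (p.1, i) (q.1, j)) p.2 q.2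
  map_add' X Y := by
    ext p q
    exact congrFun (congrFun (map_add Φ (Matrix.of fun i j => X (p.1, i) (q.1, j))
      (Matrix.of fun i j => Y (p.1, i) (q.1, j))) p.2) q.2
  map_smul' z X := by
    ext p q
    exact congrFun (congrFun (map_smul Φ z (Matrix.of fun i j => X (p.1, i) (q.1, j))) p.2) q.2

/-- `Φ ⊗ id_r`. -/
def tensorId (Φ : SuperOp a b) (r : Type*) : SuperOp (a × r) (b × r) where
  toFun X := Matrix.of fun p q => Φ (Matrix.of fun i j => X (i, p.2) (j, q.2)) p.1 q.1
  map_add' X Y := by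
    ext p q
    exact congrFun (congrFun (map_add Φ (Matrix.of fun i j => X (i, p.2) (j, q.2))
      (Matrix.of fun i j => Y (i, p.2) (j, q.2))) p.1) q.1
  map_smul' z X := by
    ext p q
    exact congrFun (congrFun (map_smul Φ z (Matrix.of fun i j => X (i, p.2) (j, q.2))) p.1) q.1

/-- `Φ ⊗ Ψ = (id ⊗ Ψ) ∘ (Φ ⊗ id)`. -/
def tensorMap (Φ : SuperOp a c) (Ψ : SuperOp b d) : SuperOp (a × b) (c × d) :=
  (idTensor c Ψ).comp (tensorId Φ b)

/-- Complete positivity: every ampliation `id_k ⊗ Φ` preserves positive semidefiniteness. -/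
def IsCP (Φ : SuperOp a b) : Prop :=
  ∀ (k : ℕ) (X : Op (Fin k × a)), X.PosSemidef → (idTensor (Fin k) Φ X).PosSemidef

/-- Trace preservation. -/
def IsTP [Fintype a] [Fintype b] (Φ : SuperOp a b) : Prop :=
  ∀ X : Op a, (Φ X).trace = X.trace

/-- The trace does not increase on positive semidefinite operators. -/
def IsTNI [Fintype a] [Fintype b] (Φ : SuperOp a b) : Prop :=
  ∀ X : Op a, X.PosSemidef → (Φ X).trace.re ≤ X.trace.re

/-- Quantum channels: completely positive and trace preserving. -/
def IsChannel [Fintype a] [Fintype b] (Φ : SuperOp a b) : Prop := IsCP Φ ∧ IsTP Φ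

/-- LOCC channels from (Alice `a`, Bob `b`) to (Alice `c`, Bob `d`): channels of the form
`∑ y, ℰ^y ⊗ ℱ^y` with all `ℰ^y`, `ℱ^y` completely positive and trace non-increasing. -/
def IsLOCC [Fintype a] [Fintype b] [Fintype c] [Fintype d]
    (Λ : SuperOp (a × b) (c × d)) : Prop :=
  IsChannel Λ ∧
    ∃ (m : ℕ) (E : Fin m → SuperOp a c) (F : Fin m → SuperOp b d),
      (∀ y, IsCP (E y) ∧ IsTNI (E y)) ∧ (∀ y, IsCP (F y) ∧ IsTNI (F y)) ∧
        Λ = ∑ y, tensorMap (E y) (F y)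

/-- The maximally entangled state `(1/M) ∑ i j, |i⟩⟨j| ⊗ |i⟩⟨j|` of Schmidt rank `M`. -/
def maxEntangled (M : ℕ) : Op (Fin M × Fin M) :=
  Matrix.of fun p q => if p.1 = p.2 ∧ q.1 = q.2 then (1 / (M : ℂ)) else 0

/-- `ω^{⊗n}` of a bipartite state, as a bipartite state of `a^n` and `b^n`. -/
def tensorPower (n : ℕ) (ω : Op (a × b)) : Op ((Fin n → a) × (Fin n → b)) :=
  Matrix.of fun p q => ∏ i, ω (p.1 i, p.2 i) (q.1 i, q.2 i)

end Basic

/-! ## Teleportation-simulable channels -/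

/-- `N : A → B` is teleportation-simulable with resource state `ω` on `A' × B'`: there is an LOCC
channel, with Alice holding `A A'`, Bob holding `B'` at the input and Bob holding `B` at the output
(Alice's output is trivial), such that `N ρ = 𝓛 (ρ ⊗ ω)` for every state `ρ`. -/
def IsTeleportationSimulable {A B A' B' : Type*} [Fintype A] [Fintype B] [Fintype A'] [Fintype B']
    (N : SuperOp A B) (ω : Op (A' × B')) : Prop :=
  ∃ Λ : SuperOp ((A × A') × B') (Unit × B), IsLOCC Λ ∧
    ∀ ρ : Op A, IsDensity ρ →
      N ρ = (Λ ((ρ ⊗ₖ ω).submatrix (fun x => (x.1.1, (x.1.2, x.2)))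
        (fun x => (x.1.1, (x.1.2, x.2))))).submatrix (fun y => ((), y)) (fun y => ((), y))

/-! ## Sequential simulation codes -/

/-- Dimensions of a sequence of memory systems: the zeroth is `M`, the later ones are given by
`f`. -/
def memDim (M : ℕ) (f : ℕ → ℕ) : ℕ → ℕ
  | 0 => M
  | i + 1 => f i

/-- The LOCC channels of a sequential simulation protocol for `n` uses that starts from a maximally
entangled state of Schmidt rank `M`. Rounds are numbered `0, …, n - 1`; before round `i`, Alice's
and Bob's memories have dimensions `memDim M dimA i` and `memDim M dimB i`. In each round Alice
holds the input `A` and Bob receives the output `B`. -/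
structure SeqProtocol (A B : Type*) [Fintype A] [Fintype B] (n M : ℕ) where
  dimA : ℕ → ℕ
  dimB : ℕ → ℕ
  step : (i : ℕ) → SuperOp ((A × Fin (memDim M dimA i)) × Fin (memDim M dimB i))
    (Fin (memDim M dimA (i + 1)) × (B × Fin (memDim M dimB (i + 1))))
  locc : ∀ i < n, IsLOCC (step i)

/-- A discrimination strategy for `n` uses (without its final measurement): an initial state of
reference and channel input, and adaptive channels between consecutive uses. -/
structure Strategy (A B : Type*) [Fintype A] [Fintype B] (n : ℕ) where
  dimR : ℕ → ℕ
  init : Op (Fin (dimR 0) × A)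
  init_density : IsDensity init
  adapt : (i : ℕ) → SuperOp (Fin (dimR i) × B) (Fin (dimR (i + 1)) × A)
  adapt_channel : ∀ i, i + 1 < n → IsChannel (adapt i)

section Sequential

variable {A B : Type*} [Fintype A] [Fintype B] {n M : ℕ}

/-- State of reference and channel input before use `i` of the actual channel. -/
def Strategy.actualIn (S : Strategy A B n) (N : SuperOp A B) :
    (i : ℕ) → Op (Fin (S.dimR i) × A)
  | 0 => S.init
  | i + 1 => S.adapt i (idTensor (Fin (S.dimR i)) N (S.actualIn N i))

/-- State of reference and channel output after use `i` of the actual channel. -/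
def Strategy.actualOut (S : Strategy A B n) (N : SuperOp A B) (i : ℕ) :
    Op (Fin (S.dimR i) × B) :=
  idTensor (Fin (S.dimR i)) N (S.actualIn N i)

/-- Round `i` of the simulation, acting on `A` and the memories, with `R` a bystander; only the
tensor factors are rearranged around `id_R ⊗ step i`. -/
def SeqProtocol.round (P : SeqProtocol A B n M) (R : Type*) (i : ℕ)
    (X : Op ((R × A) × (Fin (memDim M P.dimA i) × Fin (memDim M P.dimB i)))) :
    Op ((R × B) × (Fin (memDim M P.dimA (i + 1)) × Fin (memDim M P.dimB (i + 1)))) :=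
  (idTensor R (P.step i)
    (X.submatrix (fun x => ((x.1, x.2.1.1), (x.2.1.2, x.2.2)))
      (fun x => ((x.1, x.2.1.1), (x.2.1.2, x.2.2))))).submatrix
    (fun y => (y.1.1, (y.2.1, (y.1.2, y.2.2)))) (fun y => (y.1.1, (y.2.1, (y.1.2, y.2.2))))

/-- State of reference, channel input and memories before round `i` of the simulation. -/
def Strategy.simIn (S : Strategy A B n) (P : SeqProtocol A B n M) :
    (i : ℕ) → Op ((Fin (S.dimR i) × A) × (Fin (memDim M P.dimA i) × Fin (memDim M P.dimB i)))
  | 0 => S.init ⊗ₖ maxEntangled M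
  | i + 1 => tensorId (S.adapt i) _ (P.round (Fin (S.dimR i)) i (S.simIn P i))

/-- State of reference and channel output after round `i` of the simulation, with the memories
traced out. -/
def Strategy.simOut (S : Strategy A B n) (P : SeqProtocol A B n M) (i : ℕ) :
    Op (Fin (S.dimR i) × B) :=
  partialTraceRight (P.round (Fin (S.dimR i)) i (S.simIn P i))

/-- `P` is an `(n, M, ε)` sequential LOCC-assisted simulation code for `N`: it uses a maximally
entangled state of Schmidt rank `M ≥ 1`, and against every discrimination strategy the final states
are at normalized trace distance at most `ε`. -/
def IsSimulationCode [DecidableEq B] (N : SuperOp A B) (P : SeqProtocol A B n M) (ε : ℝ) : Prop :=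
  1 ≤ M ∧ ∀ S : Strategy A B n,
    1 / 2 * traceNorm (S.actualOut N (n - 1) - S.simOut P (n - 1)) ≤ ε

end Sequential

/-! ## Smooth entanglement of formation -/

/-- Base-two logarithm of a non-negative real, with `log₂ 0 = -∞`. -/
def log2E (t : ℝ) : EReal := if 0 < t then ((Real.logb 2 t : ℝ) : EReal) else ⊥

section EoF

variable {K L C D : Type*} [Fintype K] [Fintype L] [Fintype C] [Fintype D]
  [DecidableEq K] [DecidableEq L] [DecidableEq C]

/-- Orthogonal projection onto the support of a Hermitian operator (the span of the eigenvectors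
with non-zero eigenvalue). -/
def supportProj {ω : Op K} (hω : ω.IsHermitian) : Op K :=
  hω.cfc fun t => if t = 0 then 0 else 1

/-- Conditional entropy of order zero, `H₀(K|L)_ω = max_σ log₂ Tr (Π_ω (I ⊗ σ))` over density
operators `σ` on `L`. -/
def condEntropyZero {ω : Op (K × L)} (hω : ω.IsHermitian) : EReal :=
  ⨆ σ : {σ : Op L // IsDensity σ},
    log2E (supportProj hω * ((1 : Op K) ⊗ₖ σ.1)).trace.re

/-- A finite ensemble `{p x, φ^x}` of pure states `φ^x = |ψ x⟩⟨ψ x|` with average `τ`. -/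
structure PureEnsemble {S : Type*} [Fintype S] (τ : Op S) where
  size : ℕ
  p : Fin size → ℝ
  p_nonneg : ∀ x, 0 ≤ p x
  p_sum : ∑ x, p x = 1
  ψ : Fin size → S → ℂ
  ψ_unit : ∀ x, ∑ s, ‖ψ x s‖ ^ 2 = 1
  avg : τ = ∑ x, (p x : ℂ) • Matrix.vecMulVec (ψ x) (star (ψ x))

/-- The cq state `τ_{XC} = ∑ x, p x |x⟩⟨x| ⊗ Tr_D φ^x` of an ensemble. The classical register is
the second tensor factor, so an operator `∑ x, |x⟩⟨x| ⊗ W x` is `Matrix.blockDiagonal W`. -/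
def PureEnsemble.cqState {τ : Op (C × D)} (E : PureEnsemble τ) : Op (C × Fin E.size) :=
  Matrix.blockDiagonal fun x =>
    (E.p x : ℂ) • partialTraceRight (Matrix.vecMulVec (E.ψ x) (star (E.ψ x)))

/-- The `δ`-smooth entanglement of formation `E_{F,0}^δ(C;D)_τ`: the infimum of `H₀(C|X)` over the
pure-state ensembles of `τ` and the positive semidefinite cq operators `∑ x, |x⟩⟨x| ⊗ W x` within
trace-norm distance `δ` of the cq state of the ensemble. -/
def smoothEoF (δ : ℝ) (τ : Op (C × D)) : EReal :=
  sInf {h : EReal | ∃ (E : PureEnsemble τ) (W : Fin E.size → Op C)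
    (hW : (Matrix.blockDiagonal W).PosSemidef),
    traceNorm (Matrix.blockDiagonal W - E.cqState) ≤ δ ∧ h = condEntropyZero hW.isHermitian}

end EoF

end ChannelSim

end

/-! With perfect copies of `ω` the simulation is exact: each round spends one copy, outputs the
channel's action and leaves the other copies in product with it (`exists_round_of_split`,
`Strategy.memIn_eq_actualIn`). It remains to prepare `ω^{⊗n}` approximately, inside the first round,
from a maximally entangled state. For a fixed strategy the whole interaction is a positive,
trace-preserving linear map of the initial resource, so the final error never exceeds the
preparation error.

For the preparation (`exists_isLOCC_approx`), take a pure-state ensemble `p x`, `ψ x` and a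
smoothing `W` of its cq state, with all ranks of `W x` at most `M`. Choose subspaces of dimension
`M` containing the ranges of the `W x`. As `W` is `ε/2`-close to the cq state, the ensemble has mean
weight at most `ε/2` outside them (`sum_trace_le`). Projecting and renormalizing `ψ x` gives unit
vectors `χ x` of Schmidt rank at most `M`, at mean squared distance at most `ε`
(`exists_dist_le_of_isometry`), so the mixtures differ by at most `2√ε` in trace norm
(`exists_posSemidef_mixture_sub_eq`). The mixture of the `χ x` is obtained exactly by a
teleportation-like measurement (`exists_isLOCC_maxEntangled_eq`).

The size of `M` is controlled because `H₀(C|X)` dominates `log₂` of every rank of `W x`; the least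
attainable `M` therefore satisfies the bound (`exists_rank_le_smoothEoF`). -/

noncomputable section

namespace ChannelSim

open Matrix

/-! ## Basic facts on super-operators -/

section SuperOperators

variable {a b c d r s a₁ b₁ a₂ b₂ a₃ b₃ : Type*}

/-- Relabelling of a system along a map of the basis labels. -/
def relabel (f : b → a) : SuperOp a b where
  toFun X := X.submatrix f f
  map_add' _ _ := rfl
  map_smul' _ _ := rfl

/-- The completely positive map `X ↦ K X K†`. -/
def kraus [Fintype a] (K : Matrix b a ℂ) : SuperOp a b where
  toFun X := K * X * Kᴴ
  map_add' X Y := by rw [Matrix.mul_add, Matrix.add_mul]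
  map_smul' z X := by simp

/-- Matrix units of `a × b` are Kronecker products of matrix units, so product operators span. -/
theorem superOp_ext_kronecker [Finite a] [Finite b] {Φ Ψ : SuperOp (a × b) c}
    (h : ∀ (X : Op a) (Y : Op b), Φ (X ⊗ₖ Y) = Ψ (X ⊗ₖ Y)) : Φ = Ψ := by
  classical
  refine Matrix.ext_linearMap ℂ fun p q => LinearMap.ext_ring ?_
  have := h (Matrix.single p.1 q.1 1) (Matrix.single p.2 q.2 1)
  rw [Matrix.single_kronecker_single] at this
  simpa using this

theorem idTensor_kronecker (Φ : SuperOp a b) (X : Op r) (Y : Op a) :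
    idTensor r Φ (X ⊗ₖ Y) = X ⊗ₖ Φ Y := by
  ext p q
  exact congrFun (congrFun (map_smul Φ (X p.1 q.1) Y) p.2) q.2

theorem tensorId_kronecker (Φ : SuperOp a b) (X : Op a) (Y : Op r) :
    tensorId Φ r (X ⊗ₖ Y) = Φ X ⊗ₖ Y := by
  ext p q
  have h : (Matrix.of fun i j => (X ⊗ₖ Y) (i, p.2) (j, q.2)) = Y p.2 q.2 • X := by
    ext i j
    simp [mul_comm]
  change Φ _ p.1 q.1 = Φ X p.1 q.1 * Y p.2 q.2
  rw [h, map_smul]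
  simp [mul_comm]

theorem tensorMap_kronecker (Φ : SuperOp a c) (Ψ : SuperOp b d) (X : Op a) (Y : Op b) :
    tensorMap Φ Ψ (X ⊗ₖ Y) = Φ X ⊗ₖ Ψ Y := by
  rw [tensorMap, LinearMap.comp_apply, tensorId_kronecker, idTensor_kronecker]

theorem tensorMap_comp [Finite a₁] [Finite b₁] (Φ : SuperOp a₁ a₂) (Φ' : SuperOp a₂ a₃)
    (Ψ : SuperOp b₁ b₂) (Ψ' : SuperOp b₂ b₃) :
    tensorMap (Φ' ∘ₗ Φ) (Ψ' ∘ₗ Ψ) = tensorMap Φ' Ψ' ∘ₗ tensorMap Φ Ψ :=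
  superOp_ext_kronecker fun X Y => by simp [tensorMap_kronecker]

theorem idTensor_kraus [Fintype a] [Fintype r] [DecidableEq r] (K : Matrix b a ℂ) :
    idTensor r (kraus K) = kraus ((1 : Op r) ⊗ₖ K) :=
  superOp_ext_kronecker fun X Y => by
    rw [idTensor_kronecker]
    simp [kraus, conjTranspose_kronecker, ← mul_kronecker_mul]

theorem tensorMap_kraus [Fintype a] [Fintype b] (K : Matrix c a ℂ) (L : Matrix d b ℂ) :
    tensorMap (kraus K) (kraus L) = kraus (K ⊗ₖ L) :=
  superOp_ext_kronecker fun X Y => by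
    rw [tensorMap_kronecker]
    simp [kraus, conjTranspose_kronecker, ← mul_kronecker_mul]

/-! ### Complete positivity -/

/-- `IsCP` speaks only of references `Fin k`; an enumeration of `r` transfers it. -/
theorem IsCP.idTensor_posSemidef [Finite r] {Φ : SuperOp a b} (h : IsCP Φ) {X : Op (r × a)}
    (hX : X.PosSemidef) : (idTensor r Φ X).PosSemidef := by
  cases nonempty_fintype r
  let e := Fintype.equivFin r
  have := h (Fintype.card r) (X.submatrix (Prod.map e.symm id) (Prod.map e.symm id))
    (hX.submatrix _)
  have h2 := this.submatrix (Prod.map e id)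
  convert h2 using 1
  ext p q
  simp [idTensor]

theorem IsCP.posSemidef {Φ : SuperOp a b} (h : IsCP Φ) {X : Op a}
    (hX : X.PosSemidef) : (Φ X).PosSemidef :=
  (h 1 _ (hX.submatrix Prod.snd)).submatrix fun i => ((0 : Fin 1), i)

theorem IsCP.comp {Φ : SuperOp a b} {Ψ : SuperOp b c} (h' : IsCP Ψ) (h : IsCP Φ) :
    IsCP (Ψ ∘ₗ Φ) := fun k X hX => h' k _ (h k X hX)

theorem isCP_relabel (f : b → a) : IsCP (relabel f) := fun _ _ hX => hX.submatrix (Prod.map id f)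

theorem isCP_kraus [Fintype a] [Finite b] (K : Matrix b a ℂ) : IsCP (kraus K) := fun k X hX => by
  cases nonempty_fintype b
  rw [idTensor_kraus]
  exact hX.mul_mul_conjTranspose_same _

theorem IsCP.sum {ι : Type*} {t : Finset ι} {Φ : ι → SuperOp a b} (h : ∀ i ∈ t, IsCP (Φ i)) :
    IsCP (∑ i ∈ t, Φ i) := fun k X hX => by
  have : idTensor (Fin k) (∑ i ∈ t, Φ i) X = ∑ i ∈ t, idTensor (Fin k) (Φ i) X := by
    ext p q
    simp [idTensor, Matrix.sum_apply]
  rw [this]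
  exact posSemidef_sum _ fun i hi => h i hi k X hX

theorem IsCP.smul {Φ : SuperOp a b} (h : IsCP Φ) {t : ℝ} (ht : 0 ≤ t) :
    IsCP ((t : ℂ) • Φ) := fun k X hX => by
  have := (h k X hX).smul (a := (t : ℂ)) (by simpa using ht)
  exact this

theorem IsCP.idTensor [Finite r] {Φ : SuperOp a b} (h : IsCP Φ) : IsCP (idTensor r Φ) :=
  fun k _ hX => (h.idTensor_posSemidef
    (hX.submatrix fun x : (Fin k × r) × a => (x.1.1, (x.1.2, x.2)))).submatrix
      fun x : Fin k × (r × b) => ((x.1, x.2.1), x.2.2)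

theorem IsCP.tensorId [Finite r] {Φ : SuperOp a b} (h : IsCP Φ) : IsCP (tensorId Φ r) :=
  fun k _ hX => (h.idTensor_posSemidef
    (hX.submatrix fun x : (Fin k × r) × a => (x.1.1, (x.2, x.1.2)))).submatrix
      fun x : Fin k × (b × r) => ((x.1, x.2.2), x.2.1)

/-! ### Traces -/

variable [Fintype a] [Fintype b] [Fintype c] [Fintype d] [Fintype r] [Fintype s]

omit [Fintype a] in
theorem trace_idTensor (Φ : SuperOp a b) (X : Op (r × a)) :
    (idTensor r Φ X).trace =
      ∑ k, (Φ (X.submatrix (fun i => (k, i)) (fun i => (k, i)))).trace := by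
  rw [Matrix.trace, Fintype.sum_prod_type]
  rfl

omit [Fintype a] in
theorem trace_tensorId (Φ : SuperOp a b) (X : Op (a × r)) :
    (tensorId Φ r X).trace =
      ∑ k, (Φ (X.submatrix (fun i => (i, k)) (fun i => (i, k)))).trace := by
  rw [Matrix.trace, Fintype.sum_prod_type_right]
  rfl

theorem IsTP.idTensor {Φ : SuperOp a b} (h : IsTP Φ) : IsTP (idTensor r Φ) := fun X => by
  rw [trace_idTensor]
  simp_rw [h _]
  rw [Matrix.trace, Fintype.sum_prod_type]
  rfl

theorem IsTP.tensorId {Φ : SuperOp a b} (h : IsTP Φ) : IsTP (tensorId Φ r) := fun X => by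
  rw [trace_tensorId]
  simp_rw [h _]
  rw [Matrix.trace, Fintype.sum_prod_type_right]
  rfl

theorem isTP_relabel (e : b ≃ a) : IsTP (relabel e) := fun X =>
  e.sum_comp fun i => X i i

theorem IsTP.comp {Φ : SuperOp a b} {Ψ : SuperOp b c} (h' : IsTP Ψ) (h : IsTP Φ) :
    IsTP (Ψ ∘ₗ Φ) := fun X => (h' _).trans (h X)

theorem IsTP.isTNI {Φ : SuperOp a b} (h : IsTP Φ) : IsTNI Φ := fun X _ => by rw [h X]

theorem IsTNI.comp {Φ : SuperOp a b} {Ψ : SuperOp b c} (h' : IsTNI Ψ) (h : IsTNI Φ)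
    (hΦ : IsCP Φ) : IsTNI (Ψ ∘ₗ Φ) := fun X hX => (h' _ (hΦ.posSemidef hX)).trans (h X hX)

theorem IsTNI.tensorId {Φ : SuperOp a b} (h : IsTNI Φ) : IsTNI (tensorId Φ r) := fun X hX => by
  rw [trace_tensorId, Matrix.trace, Fintype.sum_prod_type_right, Complex.re_sum, Complex.re_sum]
  exact Finset.sum_le_sum fun k _ => h _ (hX.submatrix _)

theorem trace_kraus [DecidableEq a] (K : Matrix b a ℂ) (X : Op a) :
    (kraus K X).trace = (Kᴴ * K * X).trace := by
  rw [kraus, LinearMap.coe_mk, AddHom.coe_mk, Matrix.trace_mul_cycle, Matrix.mul_assoc]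

/-- Writing `Y` as a sum of rank-one terms `vv†` turns the trace into a sum of quadratic forms of
`X`. -/
theorem trace_mul_nonneg {X Y : Op a} (hX : X.PosSemidef) (hY : Y.PosSemidef) :
    0 ≤ (X * Y).trace.re := by
  obtain ⟨m, v, rfl⟩ := posSemidef_iff_eq_sum_vecMulVec.1 hY
  rw [Matrix.mul_sum, Matrix.trace_sum, Complex.re_sum]
  refine Finset.sum_nonneg fun i _ => ?_
  rw [Matrix.mul_vecMulVec, Matrix.trace_vecMulVec, dotProduct_comm]
  exact (Complex.le_def.1 (hX.dotProduct_mulVec_nonneg _)).1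

theorem isTNI_kraus [DecidableEq a] {K : Matrix b a ℂ} (h : (1 - Kᴴ * K).PosSemidef) :
    IsTNI (kraus K) := fun X hX => by
  rw [trace_kraus]
  have := trace_mul_nonneg h hX
  rw [Matrix.sub_mul, Matrix.one_mul, Matrix.trace_sub, Complex.sub_re] at this
  linarith

/-! ### LOCC channels -/

theorem IsLOCC.of_fintype {Λ : SuperOp (a × b) (c × d)} (hΛ : IsChannel Λ) {ι : Type*} [Fintype ι]
    (E : ι → SuperOp a c) (F : ι → SuperOp b d) (hE : ∀ y, IsCP (E y) ∧ IsTNI (E y))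
    (hF : ∀ y, IsCP (F y) ∧ IsTNI (F y)) (h : Λ = ∑ y, tensorMap (E y) (F y)) : IsLOCC Λ :=
  ⟨hΛ, Fintype.card ι, fun y => E ((Fintype.equivFin ι).symm y),
    fun y => F ((Fintype.equivFin ι).symm y), fun _ => hE _, fun _ => hF _,
    h.trans ((Fintype.equivFin ι).symm.sum_comp fun y => tensorMap (E y) (F y)).symm⟩

theorem IsChannel.comp {Φ : SuperOp a b} {Ψ : SuperOp b c} (h' : IsChannel Ψ) (h : IsChannel Φ) :
    IsChannel (Ψ ∘ₗ Φ) := ⟨h'.1.comp h.1, h'.2.comp h.2⟩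

theorem IsLOCC.comp {Λ : SuperOp (a × b) (c × d)} {Λ' : SuperOp (c × d) (r × s)}
    (h' : IsLOCC Λ') (h : IsLOCC Λ) : IsLOCC (Λ' ∘ₗ Λ) := by
  obtain ⟨hc, m, E, F, hE, hF, rfl⟩ := h
  obtain ⟨hc', m', E', F', hE', hF', rfl⟩ := h'
  refine IsLOCC.of_fintype (hc'.comp hc) (ι := Fin m' × Fin m) (fun y => E' y.1 ∘ₗ E y.2)
    (fun y => F' y.1 ∘ₗ F y.2)
    (fun _ => ⟨(hE' _).1.comp (hE _).1, (hE' _).2.comp (hE _).2 (hE _).1⟩)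
    (fun _ => ⟨(hF' _).1.comp (hF _).1, (hF' _).2.comp (hF _).2 (hF _).1⟩) ?_
  rw [Fintype.sum_prod_type]
  simp_rw [tensorMap_comp]
  refine LinearMap.ext fun X => ?_
  simp [LinearMap.sum_apply, map_sum]

/-- An LOCC channel applied to one pair of subsystems, next to idle systems `r` of Alice and `s` of
Bob. -/
theorem IsLOCC.ampliate {Λ : SuperOp (a × b) (c × d)} (h : IsLOCC Λ)
    {a' b' c' d' : Type*} [Fintype a'] [Fintype b'] [Fintype c'] [Fintype d']
    (f : a × r ≃ a') (g : b × s ≃ b') (f' : c' ≃ c × r) (g' : d' ≃ d × s) :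
    IsLOCC (relabel (fun y : c' × d' => (((f' y.1).1, (g' y.2).1), ((f' y.1).2, (g' y.2).2))) ∘ₗ
      tensorId Λ (r × s) ∘ₗ
      relabel (fun x : (a × b) × (r × s) => (f (x.1.1, x.2.1), g (x.1.2, x.2.2)))) := by
  obtain ⟨hc, m, E, F, hE, hF, hΛ⟩ := h
  refine IsLOCC.of_fintype ⟨(isCP_relabel _).comp (hc.1.tensorId.comp (isCP_relabel _)), ?_⟩
    (fun y => relabel f' ∘ₗ tensorId (E y) r ∘ₗ relabel f)
    (fun y => relabel g' ∘ₗ tensorId (F y) s ∘ₗ relabel g) (fun _ => ⟨?_, ?_⟩)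
    (fun _ => ⟨?_, ?_⟩) ?_
  · exact (isTP_relabel ((f'.prodCongr g').trans (Equiv.prodProdProdComm c r d s))).comp
      (hc.2.tensorId.comp (isTP_relabel ((Equiv.prodProdProdComm a b r s).trans (f.prodCongr g))))
  · exact (isCP_relabel _).comp ((hE _).1.tensorId.comp (isCP_relabel _))
  · exact (isTP_relabel f').isTNI.comp ((hE _).2.tensorId.comp (isTP_relabel f).isTNI
      (isCP_relabel _)) ((hE _).1.tensorId.comp (isCP_relabel _))
  · exact (isCP_relabel _).comp ((hF _).1.tensorId.comp (isCP_relabel _))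
  · exact (isTP_relabel g').isTNI.comp ((hF _).2.tensorId.comp (isTP_relabel g).isTNI
      (isCP_relabel _)) ((hF _).1.tensorId.comp (isCP_relabel _))
  · refine LinearMap.ext fun X => Matrix.ext fun p q => ?_
    simp only [LinearMap.sum_apply, Matrix.sum_apply]
    subst hΛ
    change (∑ y, tensorMap (E y) (F y)) _ _ _ = _
    rw [LinearMap.sum_apply, Matrix.sum_apply]
    rfl

end SuperOperators

/-! ## Trace norm of Hermitian operators -/

section TraceNorm

variable {a b : Type*} [Fintype a] [DecidableEq a]

/-- The operator with the eigenvectors of `X` and the eigenvalues `g i`. -/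
def eigenOp {X : Op a} (hX : X.IsHermitian) (g : a → ℝ) : Op a :=
  (hX.eigenvectorUnitary : Op a) * diagonal (fun i => (g i : ℂ)) *
    (hX.eigenvectorUnitary : Op a)ᴴ

theorem eigenvectorUnitary_conjTranspose_mul {X : Op a} (hX : X.IsHermitian) :
    (hX.eigenvectorUnitary : Op a)ᴴ * (hX.eigenvectorUnitary : Op a) = 1 :=
  Unitary.coe_star_mul_self _

theorem eigenvectorUnitary_mul_conjTranspose {X : Op a} (hX : X.IsHermitian) :
    (hX.eigenvectorUnitary : Op a) * (hX.eigenvectorUnitary : Op a)ᴴ = 1 :=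
  Unitary.coe_mul_star_self _

theorem eigenOp_eigenvalues {X : Op a} (hX : X.IsHermitian) : eigenOp hX hX.eigenvalues = X :=
  hX.spectral_theorem.symm

theorem cfc_eq_eigenOp {X : Op a} (hX : X.IsHermitian) (g : ℝ → ℝ) :
    hX.cfc g = eigenOp hX (fun i => g (hX.eigenvalues i)) := rfl

theorem trace_eigenOp {X : Op a} (hX : X.IsHermitian) (g : a → ℝ) :
    (eigenOp hX g).trace = ∑ i, (g i : ℂ) := by
  rw [eigenOp, Matrix.trace_mul_cycle, eigenvectorUnitary_conjTranspose_mul, Matrix.one_mul,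
    Matrix.trace_diagonal]

theorem eigenOp_one {X : Op a} (hX : X.IsHermitian) : eigenOp hX (fun _ => 1) = 1 := by
  simp [eigenOp, eigenvectorUnitary_mul_conjTranspose]

theorem eigenOp_sub {X : Op a} (hX : X.IsHermitian) (g g' : a → ℝ) :
    eigenOp hX (fun i => g i - g' i) = eigenOp hX g - eigenOp hX g' := by
  rw [eigenOp, eigenOp, eigenOp, ← Matrix.sub_mul, ← Matrix.mul_sub, Matrix.diagonal_sub]
  simp

theorem eigenOp_add {X : Op a} (hX : X.IsHermitian) (g g' : a → ℝ) :
    eigenOp hX (fun i => g i + g' i) = eigenOp hX g + eigenOp hX g' := by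
  rw [eigenOp, eigenOp, eigenOp, ← Matrix.add_mul, ← Matrix.mul_add, Matrix.diagonal_add]
  simp

theorem eigenOp_mul {X : Op a} (hX : X.IsHermitian) (g g' : a → ℝ) :
    eigenOp hX (fun i => g i * g' i) = eigenOp hX g * eigenOp hX g' := by
  have h := eigenvectorUnitary_conjTranspose_mul hX
  simp only [eigenOp]
  rw [← Matrix.mul_assoc, ← Matrix.mul_assoc, Matrix.mul_assoc (_ * diagonal _) _ _, h,
    Matrix.mul_one, Matrix.mul_assoc _ (diagonal _) (diagonal _), Matrix.diagonal_mul_diagonal]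
  simp

theorem eigenOp_posSemidef {X : Op a} (hX : X.IsHermitian) {g : a → ℝ} (hg : ∀ i, 0 ≤ g i) :
    (eigenOp hX g).PosSemidef :=
  (PosSemidef.diagonal fun i => by simpa using hg i).mul_mul_conjTranspose_same _

theorem traceNorm_eq_sum_abs_eigenvalues {X : Op a} (hX : X.IsHermitian) :
    traceNorm X = ∑ i, |hX.eigenvalues i| := by
  have h : (Matrix.isHermitian_conjTranspose_mul_self X).cfc Real.sqrt = hX.cfc fun t => |t| := by
    rw [← Matrix.IsHermitian.cfc_eq, ← Matrix.IsHermitian.cfc_eq]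
    have h1 : Xᴴ * X = cfc (fun t : ℝ => t * t) X := by
      rw [hX.cfc_eq, cfc_eq_eigenOp, eigenOp_mul, eigenOp_eigenvalues, hX.eq]
    rw [h1]
    refine (cfc_comp Real.sqrt (fun t : ℝ => t * t) X hX).symm.trans ?_
    congr 1
    ext t
    simp [Real.sqrt_mul_self_eq_abs]
  rw [traceNorm, h, cfc_eq_eigenOp, trace_eigenOp]
  simp

/-- Jordan decomposition: `P` and `Q` are the positive and negative parts of `X`. -/
theorem exists_posSemidef_sub_eq {X : Op a} (hX : X.IsHermitian) :
    ∃ P Q : Op a, P.PosSemidef ∧ Q.PosSemidef ∧ X = P - Q ∧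
      P.trace.re + Q.trace.re = traceNorm X := by
  refine ⟨eigenOp hX fun i => max (hX.eigenvalues i) 0,
    eigenOp hX fun i => max (-hX.eigenvalues i) 0, eigenOp_posSemidef _ fun i => le_max_right _ _,
    eigenOp_posSemidef _ fun i => le_max_right _ _, ?_, ?_⟩
  · rw [← eigenOp_sub]
    conv_lhs => rw [← eigenOp_eigenvalues hX]
    congr 1
    ext i
    rcases le_total 0 (hX.eigenvalues i) with h | h <;> simp [h]
  · rw [trace_eigenOp, trace_eigenOp, traceNorm_eq_sum_abs_eigenvalues hX, Complex.re_sum,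
      Complex.re_sum, ← Finset.sum_add_distrib]
    refine Finset.sum_congr rfl fun i _ => ?_
    rcases le_total 0 (hX.eigenvalues i) with h | h <;> simp [h, abs_of_nonneg, abs_of_nonpos]

/-- The sign operator `S` of `P - Q` satisfies `-1 ≤ S ≤ 1`, hence `Tr S(P - Q) ≤ Tr P + Tr Q`.
Errors are carried below as such pairs `P`, `Q`, since positive trace-preserving maps keep both
traces. -/
theorem traceNorm_sub_le {P Q : Op a} (hP : P.PosSemidef) (hQ : Q.PosSemidef) :
    traceNorm (P - Q) ≤ P.trace.re + Q.trace.re := by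
  have hX : (P - Q).IsHermitian := hP.isHermitian.sub hQ.isHermitian
  obtain ⟨X, hXe⟩ : ∃ X, P - Q = X := ⟨_, rfl⟩
  rw [hXe] at hX ⊢
  rw [traceNorm_eq_sum_abs_eigenvalues hX]
  let s : a → ℝ := fun i => if 0 ≤ hX.eigenvalues i then 1 else -1
  have h1 : ∑ i, |hX.eigenvalues i| = (eigenOp hX s * X).trace.re := by
    conv_rhs =>
      enter [1, 1, 2]
      rw [← eigenOp_eigenvalues hX]
    rw [← eigenOp_mul, trace_eigenOp, Complex.re_sum]
    refine Finset.sum_congr rfl fun i _ => ?_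
    by_cases h : 0 ≤ hX.eigenvalues i
    · simp [s, h, abs_of_nonneg]
    · simp [s, h, abs_of_neg (not_le.1 h)]
  have h2 : (1 - eigenOp hX s).PosSemidef := by
    rw [← eigenOp_one hX, ← eigenOp_sub]
    refine eigenOp_posSemidef _ fun i => ?_
    by_cases h : 0 ≤ hX.eigenvalues i <;> norm_num [s, h]
  have h3 : (1 + eigenOp hX s).PosSemidef := by
    rw [← eigenOp_one hX, ← eigenOp_add]
    refine eigenOp_posSemidef _ fun i => ?_
    by_cases h : 0 ≤ hX.eigenvalues i <;> norm_num [s, h]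
  have h4 := trace_mul_nonneg h2 hP
  have h5 := trace_mul_nonneg h3 hQ
  have h6 : eigenOp hX s * X = eigenOp hX s * P - eigenOp hX s * Q := by
    rw [← Matrix.mul_sub, hXe]
  rw [h1, h6, Matrix.trace_sub, Complex.sub_re]
  rw [Matrix.sub_mul, Matrix.one_mul, Matrix.trace_sub, Complex.sub_re] at h4
  rw [Matrix.add_mul, Matrix.one_mul, Matrix.trace_add, Complex.add_re] at h5
  linarith

omit [DecidableEq a] in
/-- A super-operator is determined by its values on density operators. -/
theorem superOp_ext_density {Φ Ψ : SuperOp a b} (h : ∀ ρ, IsDensity ρ → Φ ρ = Ψ ρ) : Φ = Ψ := by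
  classical
  have hpos : ∀ P : Op a, P.PosSemidef → Φ P = Ψ P := fun P hP => by
    by_cases h0 : P = 0
    · simp [h0]
    have ht : P.trace ≠ 0 := fun ht => h0 (hP.trace_eq_zero_iff.1 ht)
    have h1 := h (P.trace⁻¹ • P)
      ⟨hP.smul (inv_nonneg.2 hP.trace_nonneg), by simp [Matrix.trace_smul, ht]⟩
    rw [map_smul, map_smul] at h1
    exact smul_right_injective _ (inv_ne_zero ht) h1
  have hherm : ∀ H : Op a, H.IsHermitian → Φ H = Ψ H := fun H hH => by
    obtain ⟨P, Q, hP, hQ, rfl, -⟩ := exists_posSemidef_sub_eq hH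
    rw [map_sub, map_sub, hpos P hP, hpos Q hQ]
  refine LinearMap.ext fun X => ?_
  have hX : X = (2⁻¹ : ℂ) • (X + Xᴴ) + (-2⁻¹ * Complex.I) • (Complex.I • (X - Xᴴ)) := by
    ext i j
    simp only [Matrix.add_apply, Matrix.smul_apply, Matrix.sub_apply, smul_eq_mul]
    linear_combination (X i j - Xᴴ i j) / 2 * Complex.I_sq
  have h1 : (X + Xᴴ).IsHermitian := Matrix.isHermitian_add_transpose_self X
  have h2 : (Complex.I • (X - Xᴴ)).IsHermitian := by
    rw [Matrix.IsHermitian, Matrix.conjTranspose_smul, Matrix.conjTranspose_sub,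
      Matrix.conjTranspose_conjTranspose]
    simp [smul_sub]
    abel
  rw [hX]
  rw [map_add, map_add, map_smul Φ, map_smul Φ, map_smul Ψ, map_smul Ψ, hherm _ h1, hherm _ h2]

end TraceNorm

/-! ## Preparing an ensemble of states of Schmidt rank at most `M` from `maxEntangled M` -/

section Preparation

variable {c d : Type*} {M : ℕ}

/-- Cyclic shift by `g.1` composed with the signs `g.2`. -/
def signedShift (g : Fin M × (Fin M → ℤˣ)) : Op (Fin M) :=
  Matrix.of fun j i => if j = i + g.1 then ((g.2 i : ℤ) : ℂ) else 0

theorem units_cast_mul_self (u : ℤˣ) : ((u : ℤ) : ℂ) * ((u : ℤ) : ℂ) = 1 := by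
  rcases Int.units_eq_one_or u with rfl | rfl <;> simp

/-- Off the diagonal, flipping the sign at `i` is a bijection that negates each summand. -/
theorem sum_signs_mul (i j : Fin M) :
    ∑ s : Fin M → ℤˣ, ((s i : ℤ) : ℂ) * ((s j : ℤ) : ℂ) = if i = j then (2 : ℂ) ^ M else 0 := by
  split_ifs with h
  · subst h
    simp [units_cast_mul_self]
  · have := Equiv.sum_comp (Equiv.mulRight (Pi.mulSingle i (-1) : Fin M → ℤˣ))
      fun s : Fin M → ℤˣ => ((s i : ℤ) : ℂ) * ((s j : ℤ) : ℂ)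
    simp only [Equiv.coe_mulRight, Pi.mul_apply, Pi.mulSingle_eq_same,
      Pi.mulSingle_eq_of_ne (Ne.symm h)] at this
    simp only [mul_neg, mul_one, Units.val_neg, Int.cast_neg, neg_mul, Finset.sum_neg_distrib]
      at this
    linear_combination (-1 / 2 : ℂ) * this

theorem conjTranspose_signedShift (g : Fin M × (Fin M → ℤˣ)) :
    (signedShift g)ᴴ = (signedShift g)ᵀ := by
  ext i j
  simp only [conjTranspose_apply, transpose_apply, signedShift, of_apply]
  split_ifs <;> simp

theorem mul_signedShift_apply (Z : Matrix c (Fin M) ℂ) (g : Fin M × (Fin M → ℤˣ)) (x : c)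
    (i : Fin M) : (Z * signedShift g) x i = Z x (i + g.1) * ((g.2 i : ℤ) : ℂ) := by
  simp [Matrix.mul_apply, signedShift]

theorem signedShift_conjTranspose_mul_mul (Z : Op (Fin M)) (g : Fin M × (Fin M → ℤˣ))
    (i j : Fin M) : ((signedShift g)ᴴ * Z * signedShift g) i j =
      ((g.2 i : ℤ) : ℂ) * ((g.2 j : ℤ) : ℂ) * Z (i + g.1) (j + g.1) := by
  rw [mul_signedShift_apply, conjTranspose_signedShift, ← Matrix.transpose_transpose
    ((signedShift g)ᵀ * Z), transpose_apply, transpose_mul, transpose_transpose,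
    mul_signedShift_apply, transpose_apply]
  ring

theorem signedShift_conjTranspose_mul [NeZero M] (g : Fin M × (Fin M → ℤˣ)) :
    (signedShift g)ᴴ * signedShift g = 1 := by
  ext i j
  have := signedShift_conjTranspose_mul_mul 1 g i j
  rw [Matrix.mul_one] at this
  rw [this, Matrix.one_apply, Matrix.one_apply]
  by_cases h : i = j
  · subst h
    simp [units_cast_mul_self]
  · simp [h]

/-- The transpose, not the adjoint, appears when both parties act on the maximally entangled vector.
Real entries make the two agree, so equal shifts on both sides cancel. -/
theorem signedShift_mul_transpose [NeZero M] (g : Fin M × (Fin M → ℤˣ)) :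
    signedShift g * (signedShift g)ᵀ = 1 := by
  rw [← conjTranspose_signedShift]
  exact mul_eq_one_comm.1 (signedShift_conjTranspose_mul g)

/-- A twirl: the signs kill off-diagonal entries and the shifts spread the trace evenly over the
diagonal. -/
theorem sum_signedShift_conj [NeZero M] (Z : Op (Fin M)) :
    ∑ g, (signedShift g)ᴴ * Z * signedShift g = ((2 : ℂ) ^ M * Z.trace) • (1 : Op (Fin M)) := by
  ext i j
  rw [Matrix.sum_apply, Fintype.sum_prod_type]
  simp_rw [signedShift_conjTranspose_mul_mul, ← Finset.sum_mul, sum_signs_mul]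
  by_cases h : i = j
  · subst h
    simp only [if_true, Matrix.smul_apply, Matrix.one_apply_eq, smul_eq_mul, mul_one,
      ← Finset.mul_sum]
    congr 1
    exact Equiv.sum_comp (Equiv.addLeft i) fun k => Z k k
  · simp [h]

theorem kraus_vecMulVec [Fintype c] (K : Matrix d c ℂ) (v : c → ℂ) :
    kraus K (vecMulVec v (star v)) = vecMulVec (K *ᵥ v) (star (K *ᵥ v)) := by
  simp [kraus, Matrix.mul_vecMulVec, Matrix.vecMulVec_mul, Matrix.star_mulVec]

theorem maxEntangled_eq :
    maxEntangled M = (1 / (M : ℂ)) • vecMulVec (fun q : Fin M × Fin M => if q.1 = q.2 then 1 else 0)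
      (star fun q : Fin M × Fin M => if q.1 = q.2 then 1 else 0) := by
  ext p q
  simp only [maxEntangled, of_apply, Matrix.smul_apply, vecMulVec_apply, Pi.star_apply]
  split_ifs <;> simp_all

/-- Transpose trick: an operator on one half of the unnormalized maximally entangled vector moves to
the other half as its transpose. -/
theorem kronecker_mulVec_diag [Fintype c] (K : Matrix d c ℂ) {e : Type*} (L : Matrix e c ℂ)
    [DecidableEq c] :
    (K ⊗ₖ L) *ᵥ (fun q : c × c => if q.1 = q.2 then 1 else 0) = fun q => (K * Lᵀ) q.1 q.2 := by
  ext q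
  simp [Matrix.mulVec, dotProduct, Fintype.sum_prod_type, Matrix.mul_apply]

variable [Fintype c] [Fintype d]

theorem trace_sum_smul_kraus {ι a : Type*} [Fintype ι] [Fintype a] [DecidableEq a]
    (p : ι → ℝ) (K : ι → Matrix c a ℂ) (h : ∑ y, (p y : ℂ) • ((K y)ᴴ * K y) = 1) (X : Op a) :
    (∑ y, (p y : ℂ) • kraus (K y) X).trace = X.trace := by
  have e : X.trace = ((∑ y, (p y : ℂ) • ((K y)ᴴ * K y)) * X).trace := by
    rw [h, Matrix.one_mul]
  rw [e, Matrix.sum_mul, Matrix.trace_sum, Matrix.trace_sum]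
  refine Finset.sum_congr rfl fun y _ => ?_
  rw [Matrix.smul_mul, Matrix.trace_smul, Matrix.trace_smul, trace_kraus]

/-- The classical weight `p y` is assigned to Alice, whose operators are isometries; trace
preservation then reduces to the completeness relation `hL1` on Bob's side. -/
theorem isLOCC_sum_kraus {ι a b : Type*} [Fintype ι] [Fintype a] [Fintype b] [DecidableEq a]
    [DecidableEq b] {p : ι → ℝ} (hp : ∀ y, 0 ≤ p y) (hp1 : ∀ y, p y ≤ 1) (K : ι → Matrix c a ℂ)
    (hK : ∀ y, (K y)ᴴ * K y = 1) (L : ι → Matrix d b ℂ)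
    (hL : ∀ y, (1 - (L y)ᴴ * L y).PosSemidef) (hL1 : ∑ y, (p y : ℂ) • ((L y)ᴴ * L y) = 1) :
    IsLOCC (∑ y, (p y : ℂ) • kraus (K y ⊗ₖ L y)) := by
  refine IsLOCC.of_fintype ⟨IsCP.sum fun y _ => (isCP_kraus _).smul (hp y), fun X => ?_⟩
    (fun y => (p y : ℂ) • kraus (K y)) (fun y => kraus (L y))
    (fun y => ⟨(isCP_kraus _).smul (hp y), fun X hX => ?_⟩)
    (fun y => ⟨isCP_kraus _, isTNI_kraus (hL y)⟩) (Finset.sum_congr rfl fun y _ => ?_)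
  · rw [LinearMap.sum_apply]
    refine trace_sum_smul_kraus p (fun y => K y ⊗ₖ L y) ?_ X
    have h (y : ι) : (K y ⊗ₖ L y)ᴴ * (K y ⊗ₖ L y) = (1 : Op a) ⊗ₖ ((L y)ᴴ * L y) := by
      rw [conjTranspose_kronecker, ← mul_kronecker_mul, hK]
    rw [← one_kronecker_one, ← hL1]
    ext q q'
    simp [h, Matrix.sum_apply, Finset.mul_sum, mul_left_comm]
  · rw [LinearMap.smul_apply, Matrix.trace_smul, trace_kraus, hK, Matrix.one_mul, smul_eq_mul,
      Complex.re_ofReal_mul]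
    exact mul_le_of_le_one_left (Complex.le_def.1 hX.trace_nonneg).1 (hp1 _)
  · rw [← tensorMap_kraus]
    exact superOp_ext_kronecker fun X Y => by
      simp [tensorMap_kronecker, Matrix.smul_kronecker]

/-- The Kraus operators of the party that measures. -/
def teleportKraus (W : Matrix d (Fin M) ℂ) (g : Fin M × (Fin M → ℤˣ)) : Matrix d (Fin M) ℂ :=
  ((Real.sqrt ((2 ^ M)⁻¹) : ℝ) : ℂ) • (W * signedShift g)

theorem sqrt_mul_self_cast :
    ((Real.sqrt ((2 ^ M)⁻¹) : ℝ) : ℂ) * ((Real.sqrt ((2 ^ M)⁻¹) : ℝ) : ℂ) = ((2 : ℂ) ^ M)⁻¹ := by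
  rw [← Complex.ofReal_mul, Real.mul_self_sqrt (by positivity)]
  simp

theorem sum_teleportKraus [NeZero M] {W : Matrix d (Fin M) ℂ} (hW : (Wᴴ * W).trace = 1) :
    ∑ g, (teleportKraus W g)ᴴ * teleportKraus W g = 1 := by
  have h1 (g) : (teleportKraus W g)ᴴ * teleportKraus W g =
      ((2 : ℂ) ^ M)⁻¹ • ((signedShift g)ᴴ * (Wᴴ * W) * signedShift g) := by
    rw [teleportKraus, conjTranspose_smul, Matrix.smul_mul, Matrix.mul_smul, smul_smul,
      Complex.star_def, Complex.conj_ofReal, sqrt_mul_self_cast, conjTranspose_mul]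
    simp only [Matrix.mul_assoc]
  simp_rw [h1, ← Finset.smul_sum, sum_signedShift_conj, hW, mul_one, smul_smul]
  rw [inv_mul_cancel₀ (by positivity), one_smul]

omit [Fintype c] [Fintype d] in
-- The shifts of the two parties meet as `S Sᵀ = 1`, so every outcome `g` leaves the same vector
-- with the same weight.
theorem kraus_teleport_maxEntangled [NeZero M] (V : Matrix c (Fin M) ℂ) (W : Matrix d (Fin M) ℂ)
    (g : Fin M × (Fin M → ℤˣ)) :
    kraus ((V * signedShift g) ⊗ₖ teleportKraus W g) (maxEntangled M) =
      ((M : ℂ)⁻¹ * ((2 : ℂ) ^ M)⁻¹) • vecMulVec (fun q => (V * Wᵀ) q.1 q.2)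
        (star fun q => (V * Wᵀ) q.1 q.2) := by
  have h1 : V * signedShift g * (teleportKraus W g)ᵀ =
      ((Real.sqrt ((2 ^ M)⁻¹) : ℝ) : ℂ) • (V * Wᵀ) := by
    rw [teleportKraus, transpose_smul, transpose_mul, Matrix.mul_smul, Matrix.mul_assoc,
      ← Matrix.mul_assoc (signedShift g), signedShift_mul_transpose, Matrix.one_mul]
  rw [maxEntangled_eq, map_smul, kraus_vecMulVec, kronecker_mulVec_diag, h1, ← sqrt_mul_self_cast]
  ext q q'
  simp only [Matrix.smul_apply, vecMulVec_apply, Pi.star_apply, smul_eq_mul, star_mul',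
    Complex.star_def, Complex.conj_ofReal, one_div]
  ring

/-- The label `x` is shared randomness drawn from `p`; `g` is Bob's measurement outcome, corrected
by Alice with `signedShift g`. The `M * 2 ^ M` equal contributions restore full weight. -/
theorem exists_isLOCC_maxEntangled_eq [NeZero M] {k : ℕ} {p : Fin k → ℝ} (hp : ∀ x, 0 ≤ p x)
    (hp1 : ∑ x, p x = 1) (V : Fin k → Matrix c (Fin M) ℂ) (hV : ∀ x, (V x)ᴴ * V x = 1)
    (W : Fin k → Matrix d (Fin M) ℂ) (hW : ∀ x, ((W x)ᴴ * W x).trace = 1) :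
    ∃ Λ : SuperOp (Fin M × Fin M) (c × d), IsLOCC Λ ∧
      Λ (maxEntangled M) = ∑ x, (p x : ℂ) • vecMulVec (fun q => (V x * (W x)ᵀ) q.1 q.2)
        (star fun q => (V x * (W x)ᵀ) q.1 q.2) := by
  refine ⟨_, isLOCC_sum_kraus (ι := Fin k × (Fin M × (Fin M → ℤˣ))) (p := fun y => p y.1)
    (fun y => hp y.1)
    (fun y => hp1 ▸ Finset.single_le_sum (fun y _ => hp y) (Finset.mem_univ y.1))
    (fun y => V y.1 * signedShift y.2) (fun y => ?_) (fun y => teleportKraus (W y.1) y.2)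
    (fun y => ?_) ?_, ?_⟩
  · rw [conjTranspose_mul, Matrix.mul_assoc, ← Matrix.mul_assoc (V y.1)ᴴ, hV, Matrix.one_mul,
      signedShift_conjTranspose_mul]
  · rw [← sum_teleportKraus (hW y.1), ← Finset.add_sum_erase _ _ (Finset.mem_univ y.2),
      add_sub_cancel_left]
    exact posSemidef_sum _ fun _ _ => posSemidef_conjTranspose_mul_self _
  · rw [Fintype.sum_prod_type]
    simp_rw [← Finset.smul_sum, sum_teleportKraus (hW _), ← Finset.sum_smul,
      ← Complex.ofReal_sum, hp1]
    simp
  · have hM : (M : ℂ) ≠ 0 := by exact_mod_cast NeZero.ne M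
    rw [LinearMap.sum_apply, Fintype.sum_prod_type]
    refine Finset.sum_congr rfl fun x _ => ?_
    simp_rw [LinearMap.smul_apply, kraus_teleport_maxEntangled]
    rw [← Finset.smul_sum, Finset.sum_const, Finset.card_univ, Fintype.card_prod, Fintype.card_fin,
      Fintype.card_fun, Fintype.card_fin, Fintype.card_units_int, ← Nat.cast_smul_eq_nsmul ℂ,
      smul_smul]
    have : ((M * 2 ^ M : ℕ) : ℂ) * ((M : ℂ)⁻¹ * (2 ^ M)⁻¹) = 1 := by
      push_cast
      field_simp
    rw [smul_smul, mul_assoc, this, mul_one]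

end Preparation

/-! ## Rank and support -/

section Rank

variable {c : Type*} [Fintype c] [DecidableEq c]

theorem trace_eigenOp_support {W : Op c} (hW : W.IsHermitian) :
    (eigenOp hW fun i => if hW.eigenvalues i = 0 then 0 else 1).trace.re = W.rank := by
  rw [trace_eigenOp, hW.rank_eq_card_non_zero_eigs, Complex.re_sum, Fintype.card_subtype]
  simp only [Complex.ofReal_re]
  rw [Finset.sum_ite]
  simp

/-- The support projection `S` of `W` is `W` times its pseudo-inverse (with `0⁻¹ = 0`), so `Q S = S`
and `0 ≤ Tr Q(1 - S) = Tr Q - rank W`. -/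
theorem rank_le_trace_of_mul_eq {W Q : Op c} (hW : W.IsHermitian) (hQ : Q.PosSemidef)
    (h : Q * W = W) : (W.rank : ℝ) ≤ Q.trace.re := by
  let g : c → ℝ := fun i => if hW.eigenvalues i = 0 then 0 else 1
  have h1 : eigenOp hW g = W * eigenOp hW (fun i => (hW.eigenvalues i)⁻¹) := by
    conv_rhs =>
      enter [1]
      rw [← eigenOp_eigenvalues hW]
    rw [← eigenOp_mul]
    congr 1
    ext i
    by_cases hi : hW.eigenvalues i = 0 <;> simp [g, hi]
  have h2 : Q * eigenOp hW g = eigenOp hW g := by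
    rw [h1, ← Matrix.mul_assoc, h]
  have h3 : (1 - eigenOp hW g).PosSemidef := by
    rw [← eigenOp_one hW, ← eigenOp_sub]
    refine eigenOp_posSemidef _ fun i => ?_
    by_cases hi : hW.eigenvalues i = 0 <;> simp [g, hi]
  have h4 := trace_mul_nonneg hQ h3
  rw [Matrix.mul_sub, Matrix.mul_one, h2, Matrix.trace_sub, Complex.sub_re,
    trace_eigenOp_support hW] at h4
  linarith

/-- The columns of `V` are the eigenvectors with non-zero eigenvalue, padded with kernel
eigenvectors to exactly `M`; `hM` leaves room for the padding. -/
theorem exists_isometry_of_rank_le {W : Op c} (hW : W.IsHermitian) {M : ℕ} (h : W.rank ≤ M)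
    (hM : M ≤ Fintype.card c) :
    ∃ V : Matrix c (Fin M) ℂ, Vᴴ * V = 1 ∧ (1 - V * Vᴴ) * W = 0 := by
  rw [hW.rank_eq_card_non_zero_eigs, Fintype.card_subtype] at h
  obtain ⟨T, hST, hT⟩ := Finset.exists_superset_card_eq h hM
  let e : Fin M ≃ T := (T.equivFinOfCardEq hT).symm
  let U : Op c := hW.eigenvectorUnitary
  refine ⟨U.submatrix id fun i => (e i : c), ?_, ?_⟩
  · ext i j
    have := congrFun (congrFun (eigenvectorUnitary_conjTranspose_mul hW) (e i)) (e j)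
    refine Eq.trans this ?_
    simp [Matrix.one_apply, Subtype.ext_iff.symm]
  · have h1 : U.submatrix id (fun i => (e i : c)) * (U.submatrix id fun i => (e i : c))ᴴ =
        eigenOp hW fun i => if i ∈ T then 1 else 0 := by
      ext x y
      rw [eigenOp, Matrix.mul_apply, Matrix.mul_apply]
      simp only [Matrix.mul_diagonal]
      have := Equiv.sum_comp e fun i : T => U x i * star (U y i)
      refine this.trans ?_
      rw [Finset.sum_coe_sort T fun i => U x i * star (U y i), ← Finset.sum_filter_add_sum_filter_not
        Finset.univ (· ∈ T)]
      rw [Finset.sum_eq_zero (s := Finset.univ.filter (· ∉ T))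
        (by intro i hi; simp [(Finset.mem_filter.1 hi).2]), add_zero]
      exact Finset.sum_congr (by ext; simp) fun i hi => by simp [(Finset.mem_filter.1 hi).2, U]
    have h2 : (1 - eigenOp hW fun i => if i ∈ T then 1 else 0) * eigenOp hW hW.eigenvalues = 0 := by
      rw [← eigenOp_one hW, ← eigenOp_sub, ← eigenOp_mul]
      have : (fun i => (1 - if i ∈ T then (1 : ℝ) else 0) * hW.eigenvalues i) = fun _ => 0 := by
        ext i
        by_cases hi : i ∈ T
        · simp [hi]
        · have : hW.eigenvalues i = 0 := by
            by_contra h0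
            exact hi (hST (by simpa using h0))
          simp [this]
      rw [this]
      simp [eigenOp]
    rw [h1]
    conv_lhs =>
      enter [2]
      rw [← eigenOp_eigenvalues hW]
    exact h2

theorem supportProj_posSemidef {W : Op c} (hW : W.IsHermitian) :
    (supportProj hW).PosSemidef := by
  rw [supportProj, cfc_eq_eigenOp]
  exact eigenOp_posSemidef _ fun i => by split_ifs <;> norm_num

theorem supportProj_mul {W : Op c} (hW : W.IsHermitian) : supportProj hW * W = W := by
  have h : supportProj hW * eigenOp hW hW.eigenvalues = eigenOp hW hW.eigenvalues := by
    rw [supportProj, cfc_eq_eigenOp, ← eigenOp_mul]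
    congr 1
    ext i
    by_cases hi : hW.eigenvalues i = 0 <;> simp [hi]
  rwa [eigenOp_eigenvalues] at h

theorem log2E_mono {s t : ℝ} (h : s ≤ t) : log2E s ≤ log2E t := by
  unfold log2E
  split_ifs with h1 h2
  · exact EReal.coe_le_coe_iff.2 (Real.logb_le_logb_of_le one_lt_two h1 h)
  · exact absurd (h1.trans_le h) h2
  · exact bot_le
  · exact le_rfl

/-- Testing with `σ = |x⟩⟨x|` gives the trace of the `x`-th diagonal block of the support
projection, and this block fixes `W x`. -/
theorem log2E_rank_le_condEntropyZero {k : ℕ} {W : Fin k → Op c}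
    (hW : (Matrix.blockDiagonal W).PosSemidef) (x : Fin k) :
    log2E (W x).rank ≤ condEntropyZero hW.isHermitian := by
  have hx : (W x).IsHermitian := by
    have := (hW.submatrix fun i => (i, x)).isHermitian
    convert this using 1
    ext i j
    simp [Matrix.blockDiagonal_apply]
  let σ : Op (Fin k) := Matrix.single x x 1
  have hσ : IsDensity σ := by
    have : σ = diagonal (Pi.single x 1) := (Matrix.diagonal_single x 1).symm
    refine ⟨?_, by simp [σ]⟩
    rw [this]
    exact PosSemidef.diagonal (Pi.single_nonneg.2 zero_le_one)
  refine le_trans (log2E_mono ?_) (le_iSup (fun σ : {σ : Op (Fin k) // IsDensity σ} =>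
    log2E (supportProj hW.isHermitian * ((1 : Op c) ⊗ₖ σ.1)).trace.re) ⟨σ, hσ⟩)
  have h1 : (supportProj hW.isHermitian * ((1 : Op c) ⊗ₖ σ)).trace =
      ((supportProj hW.isHermitian).submatrix (fun i => (i, x)) fun i => (i, x)).trace := by
    simp only [Matrix.trace, Matrix.diag, Matrix.mul_apply, Fintype.sum_prod_type, σ,
      kroneckerMap_apply, Matrix.one_apply, Matrix.single_apply, submatrix_apply]
    refine Finset.sum_congr rfl fun i _ => ?_
    rw [Finset.sum_eq_single x, Finset.sum_eq_single i, Finset.sum_eq_single x]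
    · simp
    · intro y _ hy
      simp [Ne.symm hy]
    · simp
    · intro j _ hj
      simp [hj]
    · simp
    · intro y _ hy
      simp [Ne.symm hy]
    · simp
  rw [h1]
  refine rank_le_trace_of_mul_eq hx ((supportProj_posSemidef _).submatrix _) ?_
  ext i j
  have := congrFun (congrFun (supportProj_mul hW.isHermitian) (i, x)) (j, x)
  simp only [Matrix.mul_apply, Fintype.sum_prod_type, Matrix.blockDiagonal_apply] at this
  simpa [Matrix.mul_apply] using this

end Rank

/-! ## Ensembles -/

section Ensemble

variable {c d s : Type*} [Fintype c] [Fintype d] [Fintype s]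

theorem exists_pureEnsemble {τ : Op s} (hτ : IsDensity τ) : Nonempty (PureEnsemble τ) := by
  classical
  let h := hτ.1.isHermitian
  let e := (Fintype.equivFin s).symm
  let U : Op s := h.eigenvectorUnitary
  refine ⟨⟨Fintype.card s, fun x => h.eigenvalues (e x), fun x => hτ.1.eigenvalues_nonneg _, ?_,
    fun x i => U i (e x), fun x => ?_, ?_⟩⟩
  · rw [e.sum_comp h.eigenvalues]
    have := h.trace_eq_sum_eigenvalues
    rw [hτ.2] at this
    simpa using (congrArg Complex.re this).symm
  · have := congrFun (congrFun (eigenvectorUnitary_conjTranspose_mul h) (e x)) (e x)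
    rw [Matrix.mul_apply, Matrix.one_apply_eq] at this
    have h2 : ∀ i, (U i (e x) : ℂ) = (h.eigenvectorUnitary : Op s) i (e x) := fun _ => rfl
    have h3 : ((∑ i, ‖U i (e x)‖ ^ 2 : ℝ) : ℂ) = 1 := by
      rw [← this]
      push_cast
      refine Finset.sum_congr rfl fun i _ => ?_
      rw [conjTranspose_apply, Complex.star_def, Complex.conj_mul']
    exact_mod_cast h3
  · rw [e.sum_comp fun i => (h.eigenvalues i : ℂ) • vecMulVec (fun j => U j i)
      (star fun j => U j i)]
    conv_lhs => rw [← eigenOp_eigenvalues h]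
    ext i j
    rw [eigenOp, Matrix.mul_apply, Matrix.sum_apply]
    refine Finset.sum_congr rfl fun y _ => ?_
    simp [Matrix.mul_diagonal, vecMulVec_apply, U]
    ring

/-- The coefficient matrix of a bipartite vector. -/
def coeffMatrix (ψ : c × d → ℂ) : Matrix c d ℂ := Matrix.of fun i j => ψ (i, j)

omit [Fintype c] in
theorem partialTraceRight_vecMulVec (ψ : c × d → ℂ) :
    partialTraceRight (vecMulVec ψ (star ψ)) = coeffMatrix ψ * (coeffMatrix ψ)ᴴ := rfl

theorem trace_conjTranspose_mul_self (X : Matrix c d ℂ) :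
    (Xᴴ * X).trace = ((∑ i, ∑ j, ‖X i j‖ ^ 2 : ℝ) : ℂ) := by
  simp only [Matrix.trace, Matrix.diag, Matrix.mul_apply, conjTranspose_apply, Complex.star_def,
    Complex.conj_mul']
  rw [Finset.sum_comm]
  push_cast
  rfl

theorem trace_coeffMatrix {ψ : c × d → ℂ} (hψ : ∑ q, ‖ψ q‖ ^ 2 = 1) :
    ((coeffMatrix ψ)ᴴ * coeffMatrix ψ).trace = 1 := by
  rw [trace_conjTranspose_mul_self, ← Complex.ofReal_one, ← hψ, Fintype.sum_prod_type]
  rfl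

/-- For `u = w/‖w‖` the overlap is `‖w‖ ≥ ‖w‖²`. If `w = 0`, any unit matrix works, and nonemptiness
provides one. -/
theorem exists_unit_overlap [Nonempty c] [Nonempty d] (w : Matrix c d ℂ)
    (hw : (wᴴ * w).trace.re ≤ 1) :
    ∃ u : Matrix c d ℂ, (uᴴ * u).trace = 1 ∧ (wᴴ * w).trace.re ≤ (wᴴ * u).trace.re := by
  classical
  have htr := trace_conjTranspose_mul_self w
  set F : ℝ := ∑ i, ∑ j, ‖w i j‖ ^ 2 with hF
  have hF0 : 0 ≤ F := by positivity
  rw [htr, Complex.ofReal_re] at hw ⊢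
  rcases hF0.eq_or_lt with h0 | h0
  · have hw0 : w = 0 := by
      rw [← h0, Complex.ofReal_zero] at htr
      exact trace_conjTranspose_mul_self_eq_zero_iff.1 htr
    obtain ⟨i⟩ := ‹Nonempty c›
    obtain ⟨j⟩ := ‹Nonempty d›
    refine ⟨Matrix.single i j 1, ?_, ?_⟩
    · simp
    · simp [hw0, ← h0]
  · have hs := Real.sqrt_pos.2 h0
    have hss := Real.mul_self_sqrt hF0
    refine ⟨((Real.sqrt F)⁻¹ : ℂ) • w, ?_, ?_⟩
    · rw [conjTranspose_smul, Matrix.smul_mul, Matrix.mul_smul, smul_smul, Matrix.trace_smul, htr]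
      simp only [Complex.star_def, map_inv₀, Complex.conj_ofReal, smul_eq_mul]
      rw [← Complex.ofReal_inv, ← Complex.ofReal_mul, ← Complex.ofReal_mul, ← Complex.ofReal_one]
      congr 1
      field_simp
      nlinarith
    · rw [Matrix.mul_smul, Matrix.trace_smul, htr, smul_eq_mul, ← Complex.ofReal_inv,
        ← Complex.ofReal_mul, Complex.ofReal_re, le_inv_mul_iff₀ hs]
      exact mul_le_of_le_one_left hF0 (Real.sqrt_le_one.2 hw)

omit [Fintype d] in
theorem posSemidef_one_sub_mul_conjTranspose {M : ℕ} [DecidableEq c] {V : Matrix c (Fin M) ℂ}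
    (hV : Vᴴ * V = 1) : (1 - V * Vᴴ).PosSemidef := by
  have : 1 - V * Vᴴ = (1 - V * Vᴴ)ᴴ * (1 - V * Vᴴ) := by
    rw [conjTranspose_sub, conjTranspose_one, conjTranspose_mul, conjTranspose_conjTranspose,
      Matrix.mul_sub, Matrix.mul_one, Matrix.sub_mul, Matrix.one_mul, ← Matrix.mul_assoc,
      Matrix.mul_assoc V Vᴴ V, hV, Matrix.mul_one, sub_self, sub_zero]
  rw [this]
  exact posSemidef_conjTranspose_mul_self _

/-- With `w = V†Ψ` and `u` the unit matrix of `exists_unit_overlap`, the squared distance is `2 - 2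
Re⟨w, u⟩ ≤ 2(1 - ‖w‖²)`, and `1 - ‖w‖²` is the weight outside the range of `V`. -/
theorem exists_dist_le_of_isometry {M : ℕ} [NeZero M] [DecidableEq c] {V : Matrix c (Fin M) ℂ}
    (hV : Vᴴ * V = 1) {ψ : c × d → ℂ} (hψ : ∑ q, ‖ψ q‖ ^ 2 = 1) :
    ∃ W : Matrix d (Fin M) ℂ, (Wᴴ * W).trace = 1 ∧
      ∑ q : c × d, ‖ψ q - (V * Wᵀ) q.1 q.2‖ ^ 2 ≤
        2 * ((1 - V * Vᴴ) * partialTraceRight (vecMulVec ψ (star ψ))).trace.re := by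
  set Ψ := coeffMatrix ψ with hΨ
  have hΨ1 : (Ψᴴ * Ψ).trace = 1 := trace_coeffMatrix hψ
  set w := Vᴴ * Ψ with hw
  have hF : ((1 - V * Vᴴ) * partialTraceRight (vecMulVec ψ (star ψ))).trace.re =
      1 - (wᴴ * w).trace.re := by
    rw [partialTraceRight_vecMulVec, ← hΨ, Matrix.sub_mul, Matrix.one_mul, Matrix.trace_sub,
      Matrix.trace_mul_comm Ψ, hΨ1, Complex.sub_re, Complex.one_re, hw, conjTranspose_mul,
      conjTranspose_conjTranspose, ← Matrix.mul_assoc, Matrix.trace_mul_comm _ Ψᴴ]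
    simp only [Matrix.mul_assoc]
  have hpsd := posSemidef_one_sub_mul_conjTranspose hV
  have hle : (wᴴ * w).trace.re ≤ 1 := by
    have := trace_mul_nonneg hpsd (posSemidef_self_mul_conjTranspose Ψ)
    rw [← partialTraceRight_vecMulVec, hF] at this
    linarith
  have : Nonempty d := by
    by_contra h
    rw [not_nonempty_iff] at h
    simp at hψ
  obtain ⟨u, hu, hov⟩ := exists_unit_overlap w hle
  refine ⟨uᵀ, ?_, ?_⟩
  · rw [trace_conjTranspose_mul_self, Finset.sum_comm, ← hu, trace_conjTranspose_mul_self]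
    rfl
  · rw [transpose_transpose, hF]
    have h1 : ((∑ q : c × d, ‖ψ q - (V * u) q.1 q.2‖ ^ 2 : ℝ) : ℂ) =
        ((Ψ - V * u)ᴴ * (Ψ - V * u)).trace := by
      rw [trace_conjTranspose_mul_self, Fintype.sum_prod_type]
      rfl
    have h2 : ((Ψ - V * u)ᴴ * (Ψ - V * u)).trace =
        1 - (wᴴ * u).trace - star (wᴴ * u).trace + 1 := by
      have h3 : (wᴴ * u).trace = (Ψᴴ * (V * u)).trace := by
        rw [hw, conjTranspose_mul, conjTranspose_conjTranspose, Matrix.mul_assoc]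
      have h4 : star (wᴴ * u).trace = ((V * u)ᴴ * Ψ).trace := by
        rw [h3, ← Matrix.trace_conjTranspose, conjTranspose_mul, conjTranspose_conjTranspose]
      have h5 : ((V * u)ᴴ * (V * u)).trace = 1 := by
        rw [conjTranspose_mul, Matrix.mul_assoc, ← Matrix.mul_assoc Vᴴ, hV, Matrix.one_mul, hu]
      rw [h4, h3, conjTranspose_sub, Matrix.sub_mul, Matrix.mul_sub, Matrix.mul_sub,
        Matrix.trace_sub, Matrix.trace_sub, Matrix.trace_sub, hΨ1, h5]
      ring
    have h6 := congrArg Complex.re (h1.trans h2)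
    simp only [Complex.ofReal_re, Complex.add_re, Complex.sub_re, Complex.one_re,
      Complex.star_def, Complex.conj_re] at h6
    linarith

end Ensemble

/-! ## The approximate resource state -/

section Resource

variable {c d s : Type*} [Fintype c] [Fintype d] [Fintype s]

theorem trace_vecMulVec_star (v : s → ℂ) :
    (vecMulVec v (star v)).trace = ((∑ i, ‖v i‖ ^ 2 : ℝ) : ℂ) := by
  rw [trace_vecMulVec, dotProduct]
  push_cast
  exact Finset.sum_congr rfl fun i _ => Complex.mul_conj' _

theorem norm_add_sq_add_norm_sub_sq (z w : ℂ) :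
    ‖z + w‖ ^ 2 + ‖z - w‖ ^ 2 = 2 * (‖z‖ ^ 2 + ‖w‖ ^ 2) := by
  simpa [sq] using parallelogram_law_with_norm ℝ z w

/-- Two mixtures of pure states whose vectors are close in mean square are close in trace norm. -/
theorem exists_posSemidef_mixture_sub_eq {k : ℕ} {p : Fin k → ℝ} (hp : ∀ x, 0 ≤ p x)
    (hp1 : ∑ x, p x = 1) (ψ χ : Fin k → s → ℂ) (hψ : ∀ x, ∑ i, ‖ψ x i‖ ^ 2 = 1)
    (hχ : ∀ x, ∑ i, ‖χ x i‖ ^ 2 = 1) {ε : ℝ} (hε : 0 < ε)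
    (h : ∑ x, p x * ∑ i, ‖ψ x i - χ x i‖ ^ 2 ≤ ε) :
    ∃ P Q : Op s, P.PosSemidef ∧ Q.PosSemidef ∧
      ∑ x, (p x : ℂ) • vecMulVec (ψ x) (star (ψ x)) -
        ∑ x, (p x : ℂ) • vecMulVec (χ x) (star (χ x)) = P - Q ∧
      P.trace.re + Q.trace.re ≤ 2 * Real.sqrt ε := by
  have hs : 0 < Real.sqrt ε := Real.sqrt_pos.2 hε
  have hss := Real.mul_self_sqrt hε.le
  -- The choice `r² = 2/√ε` makes both terms of the final bound `r²ε/2 + 2/r²` equal to `√ε`. A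
  -- single `r` for all `x` lets the mean-square hypothesis enter linearly.
  obtain ⟨r, hr, hr2⟩ : ∃ r : ℝ, 0 < r ∧ r * r * Real.sqrt ε = 2 :=
    ⟨Real.sqrt (2 / Real.sqrt ε), by positivity, by
      rw [Real.mul_self_sqrt (by positivity)]; field_simp⟩
  -- Weighted polarization: `uu† - vv† = 4(ψψ† - χχ†)` for every `r ≠ 0`.
  let u : Fin k → s → ℂ := fun x i => r * (ψ x i - χ x i) + r⁻¹ * (ψ x i + χ x i)
  let v : Fin k → s → ℂ := fun x i => r * (ψ x i - χ x i) - r⁻¹ * (ψ x i + χ x i)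
  have hrc : (r : ℂ) ≠ 0 := by exact_mod_cast hr.ne'
  refine ⟨∑ x, ((p x / 4 : ℝ) : ℂ) • vecMulVec (u x) (star (u x)),
    ∑ x, ((p x / 4 : ℝ) : ℂ) • vecMulVec (v x) (star (v x)),
    posSemidef_sum _ fun x _ => (posSemidef_vecMulVec_self_star _).smul
      (a := ((p x / 4 : ℝ) : ℂ))
      (Complex.zero_le_real.2 (div_nonneg (hp x) (by norm_num))),
    posSemidef_sum _ fun x _ => (posSemidef_vecMulVec_self_star _).smul
      (a := ((p x / 4 : ℝ) : ℂ))
      (Complex.zero_le_real.2 (div_nonneg (hp x) (by norm_num))), ?_, ?_⟩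
  · rw [← Finset.sum_sub_distrib, ← Finset.sum_sub_distrib]
    refine Finset.sum_congr rfl fun x _ => ?_
    ext i j
    simp only [Matrix.sub_apply, Matrix.smul_apply, vecMulVec_apply, Pi.star_apply, smul_eq_mul,
      u, v, star_add, star_sub, star_mul', Complex.star_def, Complex.conj_ofReal]
    push_cast
    field_simp
    ring
  · have h1 (x : Fin k) : ∑ i, ‖u x i‖ ^ 2 + ∑ i, ‖v x i‖ ^ 2 ≤
        2 * (r * r) * ∑ i, ‖ψ x i - χ x i‖ ^ 2 + 8 * (r * r)⁻¹ := by
      have h2 : ∑ i, ‖ψ x i + χ x i‖ ^ 2 ≤ 4 := by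
        have h3 : ∑ i, ‖ψ x i + χ x i‖ ^ 2 + ∑ i, ‖ψ x i - χ x i‖ ^ 2 = 2 * (1 + 1) := by
          rw [← Finset.sum_add_distrib]
          simp_rw [norm_add_sq_add_norm_sub_sq]
          rw [← Finset.mul_sum, Finset.sum_add_distrib, hψ, hχ]
        have h4 : 0 ≤ ∑ i, ‖ψ x i - χ x i‖ ^ 2 := by positivity
        linarith
      rw [← Finset.sum_add_distrib]
      simp only [u, v, norm_add_sq_add_norm_sub_sq, norm_mul, mul_pow, Complex.norm_real,
        Real.norm_eq_abs, abs_inv, abs_of_pos hr]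
      rw [← Finset.mul_sum, Finset.sum_add_distrib, ← Finset.mul_sum, ← Finset.mul_sum]
      have h5 : (r⁻¹) ^ 2 = (r * r)⁻¹ := by rw [← sq, inv_pow]
      have h6 : 0 ≤ (r * r)⁻¹ := by positivity
      rw [h5]
      nlinarith
    simp_rw [Matrix.trace_sum, Matrix.trace_smul, trace_vecMulVec_star, Complex.re_sum, smul_eq_mul,
      ← Complex.ofReal_mul, Complex.ofReal_re]
    rw [← Finset.sum_add_distrib]
    have h7 : (r * r)⁻¹ = Real.sqrt ε / 2 := by
      rw [inv_eq_iff_eq_inv, inv_div, eq_div_iff hs.ne', hr2]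
    calc ∑ x, (p x / 4 * ∑ i, ‖u x i‖ ^ 2 + p x / 4 * ∑ i, ‖v x i‖ ^ 2)
        ≤ ∑ x, (r * r / 2 * (p x * ∑ i, ‖ψ x i - χ x i‖ ^ 2) + p x * (2 * (r * r)⁻¹)) :=
          Finset.sum_le_sum fun x _ => by
            have := mul_le_mul_of_nonneg_left (h1 x) (div_nonneg (hp x) (by norm_num : (0:ℝ) ≤ 4))
            linarith
      _ = r * r / 2 * (∑ x, p x * ∑ i, ‖ψ x i - χ x i‖ ^ 2) + 2 * (r * r)⁻¹ := by
          rw [Finset.sum_add_distrib, ← Finset.mul_sum, ← Finset.sum_mul, hp1, one_mul]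
      _ ≤ r * r / 2 * ε + 2 * (r * r)⁻¹ := by gcongr
      _ = 2 * Real.sqrt ε := by
          rw [h7]
          linear_combination (-r * r / 2) * hss + Real.sqrt ε / 2 * hr2

theorem posSemidef_blockDiagonal {k : ℕ} {W : Fin k → Op c} (h : ∀ x, (W x).PosSemidef) :
    (Matrix.blockDiagonal W).PosSemidef := by
  classical
  let R : Fin k → Op c := fun x =>
    eigenOp (h x).isHermitian fun i => Real.sqrt ((h x).isHermitian.eigenvalues i)
  have hR (x) : (R x)ᴴ * R x = W x := by
    rw [(eigenOp_posSemidef (h x).isHermitian fun i => Real.sqrt_nonneg _).isHermitian.eq,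
      ← eigenOp_mul]
    simp_rw [Real.mul_self_sqrt ((h x).eigenvalues_nonneg _)]
    exact eigenOp_eigenvalues _
  have : Matrix.blockDiagonal W = (Matrix.blockDiagonal R)ᴴ * Matrix.blockDiagonal R := by
    rw [Matrix.blockDiagonal_conjTranspose, ← Matrix.blockDiagonal_mul]
    simp_rw [hR]
  rw [this]
  exact posSemidef_conjTranspose_mul_self _

theorem trace_cqState {τ : Op (c × d)} (E : PureEnsemble τ) : E.cqState.trace = 1 := by
  have h (x) : (partialTraceRight (vecMulVec (E.ψ x) (star (E.ψ x)))).trace = 1 := by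
    rw [partialTraceRight_vecMulVec, Matrix.trace_mul_comm, trace_coeffMatrix (E.ψ_unit x)]
  rw [PureEnsemble.cqState, trace_blockDiagonal]
  simp_rw [Matrix.trace_smul, h, smul_eq_mul, mul_one]
  rw [← Complex.ofReal_sum, E.p_sum, Complex.ofReal_one]

theorem cqState_posSemidef {τ : Op (c × d)} (E : PureEnsemble τ) : E.cqState.PosSemidef := by
  refine posSemidef_blockDiagonal fun x => ?_
  rw [partialTraceRight_vecMulVec]
  exact (posSemidef_self_mul_conjTranspose _).smul (by simpa using E.p_nonneg x)

variable [DecidableEq c]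

/-- The subspaces of dimension `M` carry all but a fraction `δ` of the ensemble. -/
theorem sum_trace_le {τ : Op (c × d)} (E : PureEnsemble τ) {W : Fin E.size → Op c}
    (hW : (Matrix.blockDiagonal W).PosSemidef) {δ : ℝ}
    (hδ : traceNorm (Matrix.blockDiagonal W - E.cqState) ≤ δ) {M : ℕ}
    (V : Fin E.size → Matrix c (Fin M) ℂ) (hV : ∀ x, (V x)ᴴ * V x = 1)
    (hVW : ∀ x, (1 - V x * (V x)ᴴ) * W x = 0) :
    ∑ x, E.p x * ((1 - V x * (V x)ᴴ) *
      partialTraceRight (vecMulVec (E.ψ x) (star (E.ψ x)))).trace.re ≤ δ := by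
  obtain ⟨P, Q, hP, hQ, hPQ, htr⟩ := exists_posSemidef_sub_eq
    (hW.isHermitian.sub (cqState_posSemidef E).isHermitian)
  set T : Op (c × Fin E.size) := Matrix.blockDiagonal fun x => 1 - V x * (V x)ᴴ with hT
  have hTpsd : T.PosSemidef :=
    posSemidef_blockDiagonal fun x => posSemidef_one_sub_mul_conjTranspose (hV x)
  have hT1 : (1 - T).PosSemidef := by
    have : 1 - T = Matrix.blockDiagonal fun x => V x * (V x)ᴴ := by
      rw [hT, ← Matrix.blockDiagonal_one, ← Matrix.blockDiagonal_sub]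
      congr 1
      ext1 x
      simp
    rw [this]
    exact posSemidef_blockDiagonal fun x => posSemidef_self_mul_conjTranspose _
  have hTW : T * Matrix.blockDiagonal W = 0 := by
    rw [hT, ← Matrix.blockDiagonal_mul]
    simp_rw [hVW]
    exact Matrix.blockDiagonal_zero
  have hcq : (T * E.cqState).trace.re = ∑ x, E.p x * ((1 - V x * (V x)ᴴ) *
      partialTraceRight (vecMulVec (E.ψ x) (star (E.ψ x)))).trace.re := by
    rw [hT, PureEnsemble.cqState, ← Matrix.blockDiagonal_mul, trace_blockDiagonal, Complex.re_sum]
    refine Finset.sum_congr rfl fun x _ => ?_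
    rw [Matrix.mul_smul, Matrix.trace_smul, smul_eq_mul, Complex.re_ofReal_mul]
  -- As `T` annihilates the smoothed operator, the weight of the cq state under `T` is `Tr TQ - Tr
  -- TP ≤ Tr Q ≤ δ`.
  have h1 := congrArg (fun X => (T * X).trace.re) hPQ
  simp only [Matrix.mul_sub, hTW, Matrix.trace_sub, Complex.sub_re, zero_sub,
    Matrix.trace_neg, Complex.neg_re] at h1
  have h2 := trace_mul_nonneg hTpsd hP
  have h3 := trace_mul_nonneg hT1 hQ
  rw [Matrix.sub_mul, Matrix.one_mul, Matrix.trace_sub, Complex.sub_re] at h3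
  have h4 := (Complex.le_def.1 hP.trace_nonneg).1
  rw [Complex.zero_re] at h4
  rw [← hcq]
  linarith

/-- A nearly optimal pair in the definition of the smooth entanglement of formation, in terms of
ranks. -/
theorem exists_rank_le_smoothEoF {τ : Op (c × d)} (hτ : IsDensity τ) {δ : ℝ} (hδ0 : 0 ≤ δ)
    (hδ1 : δ < 1) :
    ∃ (M : ℕ) (E : PureEnsemble τ) (W : Fin E.size → Op c),
      (Matrix.blockDiagonal W).PosSemidef ∧
      traceNorm (Matrix.blockDiagonal W - E.cqState) ≤ δ ∧ (∀ x, (W x).rank ≤ M) ∧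
      1 ≤ M ∧ M ≤ Fintype.card c ∧ ((Real.logb 2 M : ℝ) : EReal) ≤ smoothEoF δ τ := by
  classical
  -- Minimizing over integer rank bounds avoids having to attain the infimum that defines
  -- `smoothEoF`.
  let good : ℕ → Prop := fun M => ∃ (E : PureEnsemble τ) (W : Fin E.size → Op c),
    (Matrix.blockDiagonal W).PosSemidef ∧
      traceNorm (Matrix.blockDiagonal W - E.cqState) ≤ δ ∧ ∀ x, (W x).rank ≤ M
  have hcard : good (Fintype.card c) := by
    obtain ⟨E⟩ := exists_pureEnsemble hτ
    refine ⟨E, _, cqState_posSemidef E, ?_, fun x => rank_le_card_width _⟩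
    have := traceNorm_sub_le (PosSemidef.zero (n := c × Fin E.size) (R := ℂ))
      (PosSemidef.zero (n := c × Fin E.size) (R := ℂ))
    rw [← PureEnsemble.cqState, sub_self]
    simpa using this.trans (by simpa using hδ0)
  have hex : ∃ M, good M := ⟨_, hcard⟩
  obtain ⟨E, W, hW, hd, hr⟩ := Nat.find_spec hex
  -- Rank bound zero forces `W = 0`, at trace-norm distance at least one from the normalized cq
  -- state, against `δ < 1`.
  have hpos : 1 ≤ Nat.find hex := by
    by_contra h0
    have hW0 : W = 0 := by
      ext1 x
      have h1 := hr x
      rw [Nat.lt_one_iff.1 (not_le.1 h0), Nat.le_zero] at h1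
      have h2 := LinearMap.range_eq_bot.1 (Submodule.finrank_eq_zero.1 h1)
      ext i j
      have h3 := congrFun (LinearMap.congr_fun h2 (Pi.single j 1)) i
      simpa using h3
    obtain ⟨P, Q, hP, hQ, hPQ, htr⟩ := exists_posSemidef_sub_eq
      (hW.isHermitian.sub (cqState_posSemidef E).isHermitian)
    have h1 := congrArg (fun X => X.trace.re) hPQ
    simp only [hW0, Matrix.blockDiagonal_zero, Matrix.trace_sub, trace_cqState, Complex.sub_re,
      Matrix.trace_zero, Complex.zero_re, Complex.one_re] at h1
    have h4 := (Complex.le_def.1 hP.trace_nonneg).1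
    rw [Complex.zero_re] at h4
    linarith
  refine ⟨Nat.find hex, E, W, hW, hd, hr, hpos, Nat.find_min' hex hcard, ?_⟩
  refine le_sInf ?_
  rintro h ⟨E', W', hW', hd', rfl⟩
  -- If all ranks of a competitor lay below the minimum, the minimum less one would also be good.
  obtain ⟨x, hx⟩ : ∃ x, Nat.find hex ≤ (W' x).rank := by
    by_contra hlt
    push Not at hlt
    have := Nat.find_min' hex (m := Nat.find hex - 1)
      ⟨E', W', hW', hd', fun x => Nat.le_sub_one_of_lt (hlt x)⟩
    omega
  refine le_trans ?_ (log2E_rank_le_condEntropyZero hW' x)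
  have hMpos : (0 : ℝ) < Nat.find hex := by exact_mod_cast hpos
  have h1 : log2E (Nat.find hex) = ((Real.logb 2 (Nat.find hex) : ℝ) : EReal) := if_pos hMpos
  rw [← h1]
  exact log2E_mono (by exact_mod_cast hx)

/-- Up to trace distance `√ε`, the state `τ` can be prepared by an LOCC channel from a maximally
entangled state whose Schmidt rank is governed by the smooth entanglement of formation. -/
theorem exists_isLOCC_approx {τ : Op (c × d)} (hτ : IsDensity τ) {ε : ℝ} (hε0 : 0 < ε)
    (hε1 : ε < 1) {c' d' : Type*} [Fintype c'] [Fintype d'] (f : c' ≃ c) (g : d' ≃ d) :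
    ∃ (M : ℕ) (Λ : SuperOp (Fin M × Fin M) (c' × d')) (P Q : Op (c' × d')),
      1 ≤ M ∧ ((Real.logb 2 M : ℝ) : EReal) ≤ smoothEoF (ε / 2) τ ∧ IsLOCC Λ ∧
      P.PosSemidef ∧ Q.PosSemidef ∧
      τ.submatrix (Prod.map f g) (Prod.map f g) - Λ (maxEntangled M) = P - Q ∧
      P.trace.re + Q.trace.re ≤ 2 * Real.sqrt ε := by
  obtain ⟨M, E, W, hW, hd, hr, hM1, hMc, hM⟩ := exists_rank_le_smoothEoF hτ (δ := ε / 2)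
    (by linarith) (by linarith)
  have : NeZero M := ⟨by omega⟩
  have hWh (x) : (W x).IsHermitian := by
    have := (hW.submatrix fun i => (i, x)).isHermitian
    convert this using 1
    ext i j
    simp [Matrix.blockDiagonal_apply]
  choose V hV hVW using fun x => exists_isometry_of_rank_le (hWh x) (hr x) hMc
  choose L hL hdist using fun x => exists_dist_le_of_isometry (hV x) (E.ψ_unit x)
  let χ : Fin E.size → c × d → ℂ := fun x q => (V x * (L x)ᵀ) q.1 q.2
  have hχ (x) : ∑ q, ‖χ x q‖ ^ 2 = 1 := by
    have h1 : ((V x * (L x)ᵀ)ᴴ * (V x * (L x)ᵀ)).trace = 1 := by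
      rw [conjTranspose_mul, Matrix.mul_assoc, ← Matrix.mul_assoc (V x)ᴴ, hV, Matrix.one_mul,
        ← hL x, trace_conjTranspose_mul_self, trace_conjTranspose_mul_self, Finset.sum_comm]
      rfl
    rw [trace_conjTranspose_mul_self] at h1
    rw [Fintype.sum_prod_type]
    exact_mod_cast h1
  -- The smoothing `ε/2` compensates the factor 2 in `exists_dist_le_of_isometry`.
  have hsum : ∑ x, E.p x * ∑ q, ‖E.ψ x q - χ x q‖ ^ 2 ≤ ε := by
    have h1 := sum_trace_le E hW hd V hV hVW
    refine (Finset.sum_le_sum fun x _ => mul_le_mul_of_nonneg_left (hdist x) (E.p_nonneg x)).trans ?_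
    simp_rw [mul_left_comm (E.p _) 2]
    rw [← Finset.mul_sum]
    linarith
  obtain ⟨P, Q, hP, hQ, hPQ, htr⟩ := exists_posSemidef_mixture_sub_eq E.p_nonneg E.p_sum E.ψ χ
    E.ψ_unit hχ hε0 hsum
  have htrace (X : Op (c × d)) : (X.submatrix (Prod.map f g) (Prod.map f g)).trace = X.trace :=
    isTP_relabel (f.prodCongr g) X
  obtain ⟨Λ, hΛ, hΛM⟩ := exists_isLOCC_maxEntangled_eq E.p_nonneg E.p_sum
    (fun x => (V x).submatrix f id) (fun x => by
      rw [← hV x]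
      ext i j
      exact f.sum_comp fun k => star (V x k i) * V x k j)
    (fun x => (L x).submatrix g id) (fun x => by
      rw [← hL x]
      congr 1
      ext i j
      exact g.sum_comp fun k => star (L x k i) * L x k j)
  refine ⟨M, Λ, P.submatrix (Prod.map f g) (Prod.map f g), Q.submatrix (Prod.map f g) (Prod.map f g),
    hM1, hM, hΛ, hP.submatrix _, hQ.submatrix _, ?_, by rwa [htrace, htrace]⟩
  rw [← E.avg] at hPQ
  rw [hΛM]
  refine Eq.trans ?_ (congrArg (fun X : Op (c × d) => X.submatrix (Prod.map f g) (Prod.map f g)) hPQ)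
  ext q q'
  simp only [Matrix.sub_apply, Matrix.submatrix_apply, Matrix.sum_apply, Matrix.smul_apply,
    vecMulVec_apply]
  rfl

end Resource

/-! ## Tensor powers -/

section TensorPower

variable {a b : Type*}

/-- The equation `k = m + 1` is a hypothesis so that `k = n - i`, `m = n - (i + 1)` can be used
without casts. -/
theorem exists_tensorPower_succ (ω : Op (a × b)) {k m : ℕ} (h : k = m + 1) :
    ∃ (f : a × (Fin m → a) ≃ (Fin k → a)) (g : b × (Fin m → b) ≃ (Fin k → b)),
      ∀ x y : (a × b) × ((Fin m → a) × (Fin m → b)),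
        tensorPower k ω (f (x.1.1, x.2.1), g (x.1.2, x.2.2)) (f (y.1.1, y.2.1), g (y.1.2, y.2.2)) =
          ω x.1 y.1 * tensorPower m ω x.2 y.2 := by
  subst h
  refine ⟨Fin.consEquiv fun _ => a, Fin.consEquiv fun _ => b, fun x y => ?_⟩
  simp [tensorPower, Fin.prod_univ_succ, Fin.consEquiv]

variable [Fintype a] [Fintype b]

theorem isDensity_tensorPower {ω : Op (a × b)} (hω : IsDensity ω) (n : ℕ) :
    IsDensity (tensorPower n ω) := by
  induction n with
  | zero =>
    have : tensorPower 0 ω = 1 := by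
      ext p q
      rw [Subsingleton.elim q p, Matrix.one_apply_eq]
      simp [tensorPower]
    rw [this]
    exact ⟨PosSemidef.one, by simp⟩
  | succ n ih =>
    obtain ⟨f, g, h⟩ := exists_tensorPower_succ ω (rfl : n + 1 = n + 1)
    let e := (Equiv.prodProdProdComm a b (Fin n → a) (Fin n → b)).trans (f.prodCongr g)
    have he : (tensorPower (n + 1) ω).submatrix e e = ω ⊗ₖ tensorPower n ω :=
      Matrix.ext fun x y => h x y
    refine ⟨(posSemidef_submatrix_equiv e).1 (he ▸ hω.1.kronecker ih.1), ?_⟩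
    have h1 : ((tensorPower (n + 1) ω).submatrix e e).trace = (tensorPower (n + 1) ω).trace :=
      isTP_relabel e _
    rw [← h1, he, trace_kronecker, hω.2, ih.2, one_mul]

end TensorPower

/-! ## Sequential simulation -/

section Rounds

variable {A B A' B' R a b a' b' a'' b'' : Type*}

/-- One round of a simulation in which the memories `a`, `b` become `a'`, `b'`. -/
def roundMap (R : Type*) (V : SuperOp ((A × a) × b) (a' × (B × b'))) :
    SuperOp ((R × A) × (a × b)) ((R × B) × (a' × b')) :=
  relabel (fun y => (y.1.1, (y.2.1, (y.1.2, y.2.2)))) ∘ₗ idTensor R V ∘ₗ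
    relabel fun x => ((x.1, x.2.1.1), (x.2.1.2, x.2.2))

/-- `Y ↦ X ⊗ Y`. -/
def kroneckerLeft (X : Op a) : SuperOp b (a × b) where
  toFun Y := X ⊗ₖ Y
  map_add' := kronecker_add X
  map_smul' z := kronecker_smul z X

/-- `X ↦ X ⊗ Y`. -/
def kroneckerRight (Y : Op b) : SuperOp a (a × b) where
  toFun X := X ⊗ₖ Y
  map_add' X X' := add_kronecker X X' Y
  map_smul' z X := smul_kronecker z X Y

variable [Fintype A] [Fintype B] [Fintype A'] [Fintype B'] [Fintype R] [Fintype a] [Fintype b]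
  [Fintype a'] [Fintype b'] [Fintype a''] [Fintype b'']

theorem IsChannel.roundMap {V : SuperOp ((A × a) × b) (a' × (B × b'))} (h : IsChannel V) :
    IsChannel (roundMap R V) := by
  let e : (R × B) × (a' × b') ≃ R × (a' × (B × b')) :=
    ⟨fun y => (y.1.1, (y.2.1, (y.1.2, y.2.2))), fun y => ((y.1, y.2.2.1), (y.2.1, y.2.2.2)),
      fun _ => rfl, fun _ => rfl⟩
  let e' : R × ((A × a) × b) ≃ (R × A) × (a × b) :=
    ⟨fun x => ((x.1, x.2.1.1), (x.2.1.2, x.2.2)), fun x => (x.1.1, ((x.1.2, x.2.1), x.2.2)),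
      fun _ => rfl, fun _ => rfl⟩
  exact IsChannel.comp ⟨isCP_relabel _, isTP_relabel e⟩
    (IsChannel.comp ⟨h.1.idTensor, h.2.idTensor⟩ ⟨isCP_relabel _, isTP_relabel e'⟩)

omit [Fintype a] in
theorem partialTraceRight_kronecker (X : Op a) (Y : Op b) :
    partialTraceRight (X ⊗ₖ Y) = Y.trace • X := by
  ext i j
  simp [partialTraceRight, Matrix.trace, ← Finset.mul_sum, mul_comm]

omit [Fintype a] in
theorem partialTraceRight_sub (X Y : Op (a × b)) :
    partialTraceRight (X - Y) = partialTraceRight X - partialTraceRight Y := by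
  ext i j
  simp [partialTraceRight]

omit [Fintype a] in
theorem partialTraceRight_posSemidef {X : Op (a × b)} (hX : X.PosSemidef) :
    (partialTraceRight X).PosSemidef := by
  have : partialTraceRight X = ∑ k, X.submatrix (fun i => (i, k)) fun i => (i, k) := by
    ext i j
    simp [partialTraceRight, Matrix.sum_apply]
  rw [this]
  exact posSemidef_sum _ fun k _ => hX.submatrix _

theorem trace_partialTraceRight (X : Op (a × b)) : (partialTraceRight X).trace = X.trace :=
  (Fintype.sum_prod_type fun x => X x x).symm

/-- The identity on states extends linearly to all operators; this is needed since the blocks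
`⟨r|X|r'⟩` of an operator on `R × A` are not states. -/
theorem IsTeleportationSimulable.exists_isLOCC {N : SuperOp A B} {ω : Op (A' × B')}
    (h : IsTeleportationSimulable N ω) :
    ∃ Λ : SuperOp ((A × A') × B') (Unit × B), IsLOCC Λ ∧ ∀ (X : Op A) (i j : B),
      Λ ((X ⊗ₖ ω).submatrix (fun x => (x.1.1, (x.1.2, x.2))) fun x => (x.1.1, (x.1.2, x.2)))
        ((), i) ((), j) = N X i j := by
  obtain ⟨Λ, hΛ, hN⟩ := h
  refine ⟨Λ, hΛ, fun X i j => ?_⟩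
  have : N = relabel (fun y => ((), y)) ∘ₗ Λ ∘ₗ
      relabel (fun x => (x.1.1, (x.1.2, x.2))) ∘ₗ kroneckerRight ω :=
    superOp_ext_density hN
  rw [this]
  rfl

/-- Consumption of one copy of the resource in a round: the resource `Ω` in the memories splits as
`ω ⊗ Ω'`, and `Ω'` is kept. -/
theorem exists_round_of_split {N : SuperOp A B} {ω : Op (A' × B')}
    (h : IsTeleportationSimulable N ω) (Ω : Op (a × b)) (Ω' : Op (a' × b'))
    (f : A' × a' ≃ a) (g : B' × b' ≃ b)
    (hΩ : ∀ x y : (A' × B') × (a' × b'),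
      Ω (f (x.1.1, x.2.1), g (x.1.2, x.2.2)) (f (y.1.1, y.2.1), g (y.1.2, y.2.2)) =
        ω x.1 y.1 * Ω' x.2 y.2) :
    ∃ V : SuperOp ((A × a) × b) (a' × (B × b')), IsLOCC V ∧
      ∀ (k : ℕ) (X : Op (Fin k × A)),
        roundMap (Fin k) V (X ⊗ₖ Ω) = idTensor (Fin k) N X ⊗ₖ Ω' := by
  obtain ⟨Λ, hΛ, hN⟩ := h.exists_isLOCC
  refine ⟨_, hΛ.ampliate ((Equiv.prodAssoc A A' a').trans ((Equiv.refl A).prodCongr f)) g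
    (Equiv.punitProd a').symm (Equiv.refl (B × b')), fun k X => ?_⟩
  ext p q
  -- With the indices of the reference and of the kept copies fixed, the input of `Λ` is a scalar
  -- entry of `Ω'` times a block of `X` tensored with `ω`.
  have key : (Matrix.of fun x y : (A × A') × B' => (X ⊗ₖ Ω)
      ((p.1.1, x.1.1), (f (x.1.2, p.2.1), g (x.2, p.2.2)))
      ((q.1.1, y.1.1), (f (y.1.2, q.2.1), g (y.2, q.2.2)))) = Ω' p.2 q.2 •
      ((Matrix.of fun i j => X (p.1.1, i) (q.1.1, j)) ⊗ₖ ω).submatrix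
        (fun x => (x.1.1, (x.1.2, x.2))) fun x => (x.1.1, (x.1.2, x.2)) := by
    ext x y
    have := hΩ ((x.1.2, x.2), p.2) ((y.1.2, y.2), q.2)
    simp only [of_apply, kroneckerMap_apply, Matrix.smul_apply, submatrix_apply, smul_eq_mul] at *
    rw [this]
    ring
  refine (congrFun (congrFun (congrArg Λ key) ((), p.1.2)) ((), q.1.2)).trans ?_
  rw [map_smul, Matrix.smul_apply, hN, smul_eq_mul, mul_comm]
  rfl

/-- A round that is preceded by the preparation of the resource. -/
theorem exists_round_of_preparation {V : SuperOp ((A × a) × b) (a' × (B × b'))} (hV : IsLOCC V)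
    {Λ : SuperOp (a'' × b'') (a × b)} (hΛ : IsLOCC Λ) :
    ∃ V' : SuperOp ((A × a'') × b'') (a' × (B × b')), IsLOCC V' ∧
      ∀ (k : ℕ) (X : Op (Fin k × A)) (Φ : Op (a'' × b'')),
        roundMap (Fin k) V' (X ⊗ₖ Φ) = roundMap (Fin k) V (X ⊗ₖ Λ Φ) := by
  obtain ⟨T, hT, h⟩ : ∃ T : SuperOp ((A × a'') × b'') ((A × a) × b), IsLOCC T ∧
      ∀ (k : ℕ) (X : Op (Fin k × A)) (Φ : Op (a'' × b'')), idTensor (Fin k) T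
        (relabel (fun x => ((x.1, x.2.1.1), (x.2.1.2, x.2.2))) (X ⊗ₖ Φ)) =
          relabel (fun x => ((x.1, x.2.1.1), (x.2.1.2, x.2.2))) (X ⊗ₖ Λ Φ) := by
    -- The channel input `A` is Alice's idle system; Bob's is the one-point type.
    refine ⟨_, hΛ.ampliate (Equiv.prodComm a'' A) (Equiv.prodPUnit.{0, _} b'')
      (Equiv.prodComm A a) (Equiv.prodPUnit.{0, _} b).symm, fun k X Φ => ?_⟩
    ext p q
    exact congrFun (congrFun (map_smul Λ (X (p.1, p.2.1.1) (q.1, q.2.1.1)) Φ)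
      (p.2.1.2, p.2.2)) (q.2.1.2, q.2.2)
  exact ⟨V ∘ₗ T, hV.comp hT, fun k X Φ => congrArg
    (fun Z => relabel (fun y : (Fin k × B) × (a' × b') => (y.1.1, (y.2.1, (y.1.2, y.2.2))))
      (idTensor (Fin k) V Z)) (h k X Φ)⟩

end Rounds

/-! ### The interaction as a linear map of the initial resource -/

section Simulation

variable {A B : Type*} [Fintype A] [Fintype B] {n : ℕ} {mA mB : ℕ → ℕ}

/-- State before round `i` of the simulation with rounds `V` and an arbitrary initial resource. -/
def Strategy.memIn (S : Strategy A B n)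
    (V : ∀ i, SuperOp ((A × Fin (mA i)) × Fin (mB i)) (Fin (mA (i + 1)) × (B × Fin (mB (i + 1))))) :
    ∀ i, SuperOp (Fin (mA 0) × Fin (mB 0)) ((Fin (S.dimR i) × A) × (Fin (mA i) × Fin (mB i)))
  | 0 => kroneckerLeft S.init
  | i + 1 => tensorId (S.adapt i) _ ∘ₗ roundMap (Fin (S.dimR i)) (V i) ∘ₗ S.memIn V i

variable (S : Strategy A B n)
  {V : ∀ i, SuperOp ((A × Fin (mA i)) × Fin (mB i)) (Fin (mA (i + 1)) × (B × Fin (mB (i + 1))))}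

theorem Strategy.memIn_posSemidef_trace (hV : ∀ i < n, IsChannel (V i))
    {X : Op (Fin (mA 0) × Fin (mB 0))} (hX : X.PosSemidef) (i : ℕ) (hi : i < n) :
    (S.memIn V i X).PosSemidef ∧ (S.memIn V i X).trace = X.trace := by
  induction i with
  | zero =>
    refine ⟨S.init_density.1.kronecker hX, (trace_kronecker _ _).trans ?_⟩
    rw [S.init_density.2, one_mul]
  | succ i ih =>
    obtain ⟨h1, h2⟩ := ih (by omega)
    have hr := (hV i (by omega)).roundMap (R := Fin (S.dimR i))
    have ha := S.adapt_channel i hi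
    exact ⟨ha.1.tensorId.posSemidef (hr.1.posSemidef h1),
      (ha.2.tensorId _).trans ((hr.2 _).trans h2)⟩

/-- Exact rounds keep the unused resource in product with the strategy's systems, so the adaptive
channels act as they would on the actual channel. -/
theorem Strategy.memIn_eq_actualIn {N : SuperOp A B} {Ω : ∀ i, Op (Fin (mA i) × Fin (mB i))}
    (hV : ∀ i < n, ∀ (k : ℕ) (X : Op (Fin k × A)),
      roundMap (Fin k) (V i) (X ⊗ₖ Ω i) = idTensor (Fin k) N X ⊗ₖ Ω (i + 1))
    (i : ℕ) (hi : i < n) : S.memIn V i (Ω 0) = S.actualIn N i ⊗ₖ Ω i := by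
  induction i with
  | zero => rfl
  | succ i ih =>
    change tensorId (S.adapt i) _ (roundMap _ (V i) (S.memIn V i (Ω 0))) = _
    rw [ih (by omega), hV i (by omega), tensorId_kronecker]
    rfl

/-- The protocol with rounds `V`, the first of which is replaced by `V₀`. -/
def protocolOfRounds {M : ℕ} (hV : ∀ i < n, IsLOCC (V i))
    {V₀ : SuperOp ((A × Fin M) × Fin M) (Fin (mA 1) × (B × Fin (mB 1)))} (hV₀ : IsLOCC V₀) :
    SeqProtocol A B n M where
  -- Since `memDim` has `M` at index zero, the shift makes later rounds match the types of `V (i +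
  -- 1)` definitionally.
  dimA i := mA (i + 1)
  dimB i := mB (i + 1)
  step
    | 0 => V₀
    | i + 1 => V (i + 1)
  locc
    | 0, _ => hV₀
    | i + 1, hi => hV (i + 1) hi

/-- The states are compared after a round, not before: before round zero the memories of the two
runs have different sizes. -/
theorem Strategy.round_simIn_protocolOfRounds {M : ℕ} (hV : ∀ i < n, IsLOCC (V i))
    {V₀ : SuperOp ((A × Fin M) × Fin M) (Fin (mA 1) × (B × Fin (mB 1)))} (hV₀ : IsLOCC V₀)
    {X : Op (Fin (mA 0) × Fin (mB 0))}
    (h : ∀ (k : ℕ) (Y : Op (Fin k × A)),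
      roundMap (Fin k) V₀ (Y ⊗ₖ maxEntangled M) = roundMap (Fin k) (V 0) (Y ⊗ₖ X)) (i : ℕ) :
    (protocolOfRounds hV hV₀).round (Fin (S.dimR i)) i (S.simIn (protocolOfRounds hV hV₀) i) =
      roundMap (Fin (S.dimR i)) (V i) (S.memIn V i X) := by
  induction i with
  | zero => exact h _ _
  | succ i ih =>
    exact congrArg (fun Y => roundMap (Fin (S.dimR (i + 1))) (V (i + 1))
      (tensorId (S.adapt i) (Fin (mA (i + 1)) × Fin (mB (i + 1))) Y)) ih

end Simulation

/-! ### Spending `ω^{⊗n}` one copy per round -/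

section Main

variable {A B A' B' : Type*} [Fintype A] [Fintype B] [Fintype A'] [Fintype B']

/-- The copies of the resource state that are left before round `i`. -/
theorem exists_resource_rounds {N : SuperOp A B} {ω : Op (A' × B')}
    (h : IsTeleportationSimulable N ω) (hω : IsDensity ω) (n : ℕ) :
    ∃ (mA mB : ℕ → ℕ) (f : Fin (mA 0) ≃ (Fin n → A')) (g : Fin (mB 0) ≃ (Fin n → B'))
      (Ω : ∀ i, Op (Fin (mA i) × Fin (mB i)))
      (V : ∀ i, SuperOp ((A × Fin (mA i)) × Fin (mB i))
        (Fin (mA (i + 1)) × (B × Fin (mB (i + 1))))),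
      Ω 0 = (tensorPower n ω).submatrix (Prod.map f g) (Prod.map f g) ∧
      (∀ i, (Ω i).trace = 1) ∧ (∀ i < n, IsLOCC (V i)) ∧
      ∀ i < n, ∀ (k : ℕ) (X : Op (Fin k × A)),
        roundMap (Fin k) (V i) (X ⊗ₖ Ω i) = idTensor (Fin k) N X ⊗ₖ Ω (i + 1) := by
  classical
  let f (i : ℕ) : Fin (Fintype.card (Fin (n - i) → A')) ≃ (Fin (n - i) → A') :=
    (Fintype.equivFin _).symm
  let g (i : ℕ) : Fin (Fintype.card (Fin (n - i) → B')) ≃ (Fin (n - i) → B') :=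
    (Fintype.equivFin _).symm
  -- For `i ≥ n` the truncated `n - i` is zero and `Ω i` is the empty tensor power, still of trace
  -- one.
  let Ω (i : ℕ) := (tensorPower (n - i) ω).submatrix (Prod.map (f i) (g i)) (Prod.map (f i) (g i))
  have hV (i : ℕ) : ∃ V : SuperOp ((A × Fin (Fintype.card (Fin (n - i) → A'))) ×
      Fin (Fintype.card (Fin (n - i) → B')))
      (Fin (Fintype.card (Fin (n - (i + 1)) → A')) ×
        (B × Fin (Fintype.card (Fin (n - (i + 1)) → B')))), i < n → IsLOCC V ∧
      ∀ (k : ℕ) (X : Op (Fin k × A)),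
        roundMap (Fin k) V (X ⊗ₖ Ω i) = idTensor (Fin k) N X ⊗ₖ Ω (i + 1) := by
    by_cases hi : i < n
    · obtain ⟨f', g', hs⟩ := exists_tensorPower_succ ω (by omega : n - i = n - (i + 1) + 1)
      obtain ⟨V, hV⟩ := exists_round_of_split h (Ω i) (Ω (i + 1))
        (((Equiv.refl A').prodCongr (f (i + 1))).trans (f'.trans (f i).symm))
        (((Equiv.refl B').prodCongr (g (i + 1))).trans (g'.trans (g i).symm)) (fun x y => by
          have := hs (x.1, (f (i + 1) x.2.1, g (i + 1) x.2.2))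
            (y.1, (f (i + 1) y.2.1, g (i + 1) y.2.2))
          simpa [Ω, Prod.map] using this)
      exact ⟨V, fun _ => hV⟩
    · exact ⟨0, fun h => absurd h hi⟩
  choose V hV using hV
  exact ⟨fun i => Fintype.card (Fin (n - i) → A'), fun i => Fintype.card (Fin (n - i) → B'),
    f 0, g 0, Ω, V, rfl, fun i => (isTP_relabel ((f i).prodCongr (g i)) _).trans
      (isDensity_tensorPower hω _).2, fun i hi => (hV i hi).1, fun i hi => (hV i hi).2⟩

end Main

end ChannelSim

end

/-! ### Assembly of the code -/

theorem mainTheorem7 {A B A' B' : Type*} [Fintype A] [Fintype B] [Fintype A'] [Fintype B']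
    [DecidableEq B] [DecidableEq A']
    (N : ChannelSim.SuperOp A B) (hN : ChannelSim.IsChannel N)
    (ω : ChannelSim.Op (A' × B')) (hω : ChannelSim.IsDensity ω)
    (hsim : ChannelSim.IsTeleportationSimulable N ω)
    (n : ℕ) (hn : 1 ≤ n) (ε : ℝ) (hε0 : 0 < ε) (hε1 : ε < 1) :
    ∃ (M : ℕ) (P : ChannelSim.SeqProtocol A B n M),
      ChannelSim.IsSimulationCode N P (Real.sqrt ε) ∧
        ((1 / (n : ℝ) * Real.logb 2 (M : ℝ) : ℝ) : EReal) ≤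
          ((1 / (n : ℝ) : ℝ) : EReal) *
            ChannelSim.smoothEoF (ε / 2) (ChannelSim.tensorPower n ω) := by
  open ChannelSim in
  obtain ⟨mA, mB, f, g, Ω, V, hΩ0, hΩ, hV, hVN⟩ := exists_resource_rounds hsim hω n
  obtain ⟨M, Λ, P, Q, hM1, hM, hΛ, hP, hQ, hPQ, htr⟩ :=
    exists_isLOCC_approx (isDensity_tensorPower hω n) hε0 hε1 f g
  obtain ⟨V₀, hV₀, hV₀V⟩ := exists_round_of_preparation (hV 0 (by omega)) hΛ
  refine ⟨M, protocolOfRounds hV hV₀, ⟨hM1, fun S => ?_⟩, ?_⟩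
  -- `G` sends the initial resource to the final state with the memories discarded; it is positive
  -- and trace preserving.
  · let G := fun X => partialTraceRight (roundMap (Fin (S.dimR (n - 1))) (V (n - 1))
      (S.memIn V (n - 1) X))
    have hsub (X Y) : G (X - Y) = G X - G Y := by
      simp only [G, map_sub, partialTraceRight_sub]
    have hG {X} (hX : Matrix.PosSemidef X) : (G X).PosSemidef ∧ (G X).trace = X.trace := by
      have h1 := S.memIn_posSemidef_trace (fun i hi => (hV i hi).1) hX (n - 1) (by omega)
      have h2 := (hV (n - 1) (by omega)).1.roundMap (R := Fin (S.dimR (n - 1)))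
      exact ⟨partialTraceRight_posSemidef (h2.1.posSemidef h1.1),
        (trace_partialTraceRight _).trans ((h2.2 _).trans h1.2)⟩
    have hact : S.actualOut N (n - 1) = G (Ω 0) := by
      simp only [G]
      rw [S.memIn_eq_actualIn hVN (n - 1) (by omega), hVN (n - 1) (by omega),
        partialTraceRight_kronecker, hΩ, one_smul]
      rfl
    have hsimOut : S.simOut (protocolOfRounds hV hV₀) (n - 1) = G (Λ (maxEntangled M)) :=
      congrArg partialTraceRight
        (S.round_simIn_protocolOfRounds hV hV₀ (fun k Y => hV₀V k Y _) (n - 1))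
    -- The difference of outputs is `G P - G Q`, of trace norm at most `Tr P + Tr Q ≤ 2√ε`; the
    -- normalization `1/2` leaves `√ε`.
    rw [hact, hsimOut, ← hsub, hΩ0, hPQ, hsub]
    have h1 := traceNorm_sub_le (hG hP).1 (hG hQ).1
    rw [(hG hP).2, (hG hQ).2] at h1
    linarith
  · rw [EReal.coe_mul]
    exact mul_le_mul_of_nonneg_left hM (EReal.coe_nonneg.2 (by positivity))
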